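/- **Setting.** Let $n\in\{2,3\}$, let $\Omega\subset\mathbb R^n$ be a bounded measurable set, and let $C,E_0,mc^2>0$. Let $K\subset\mathbb R^n\times\mathbb R^n$ be a compact set of detector–source pairs $(\mathbf d,\mathbf s)$ such that $\mathbf d\ne\mathbf s$ and $\mathbf d,\mathbf s\notin\overline\Omega$ for all $(\mathbf d,\mathbf s)\in K$, and let $\nu$ be a finite Borel measure on $\mathbb R^n\times\mathbb R^n$ concentrated on $K$. For a scattering angle $\omega$ let $\mathrm E(\omega)=E_0/\bigl(1+\tfrac{E_0}{mc^2}(1-\cos\omega)\bigr)$ and put $$\phi(\mathbf x,\mathbf d,\mathbf s)=\mathrm E\Bigl(\cot^{-1}\frac{\kappa-\rho}{\sqrt{1-\kappa^2}}\Bigr),\qquad \kappa=\frac{(\mathbf x-\mathbf s)\cdot(\mathbf d-\mathbf s)}{\|\mathbf x-\mathbf s\|\,\|\mathbf d-\mathbf s\|},\qquad \rho=\frac{\|\mathbf x-\mathbf s\|}{\|\mathbf d-\mathbf s\|},$$ with $\cot^{-1}$ taking values in $(0,\pi)$. Let $\mathbb E$ be a measurable set of energies with $\overline{\mathbb E}\subset(\mathrm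 E(\pi),E_0)$, and let $\mathcal Y=L^2(\mathbb E\times K;\,dE\otimes d\nu)$. For $f$ on $\Omega$, extended by zero, let $\mathfrak X f(\mathbf x,\mathbf d,\mathbf s)=\int_{\mathbf s\to\mathbf x}f+\int_{\mathbf x\to\mathbf d}f$ (integrals with respect to arc length over the two segments), and let $$\mathfrak W_1(f)(\mathbf x,\mathbf d,\mathbf s)=C\,\frac{\exp(-\mathfrak X f(\mathbf x,\mathbf d,\mathbf s))}{\|\mathbf x-\mathbf s\|^2\,\|\mathbf d-\mathbf x\|^2}.$$ For $g$ integrable on $\Omega\times K$ with respect to $d\mathbf x\otimes d\nu$, the identity $u(E,\mathbf d,\mathbf s)=\int_\Omega g(\mathbf x,\mathbf d,\mathbf s)\,\delta(E-\phi(\mathbf x,\mathbf d,\mathbf s))\,d\mathbf x$ means that $u\in L^1(\mathbb E\times K; dE\otimes d\nu)$ and $$\int\!\!\int_{\mathbb E}u\,\psi\;dE\,d\nu=\int\!\!\int_{\{\mathbf x\in\Omega:\ \phi(\mathbf x,\mathbf d,\mathbf s)\in\mathbb E\}}g(\mathbf x,\mathbf d,\mathbf s)\,\psi(\phi(\mathbf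 x,\mathbf d,\mathbf s),\mathbf d,\mathbf s)\;d\mathbf x\,d\nu(\mathbf d,\mathbf s)$$ for all bounded measurable $\psi$; this determines $u$ almost everywhere. Finally put $$\mathfrak L_1(f)(E,\mathbf d,\mathbf s)=\int_\Omega \mathfrak W_1(f)(\mathbf x,\mathbf d,\mathbf s)\,f(\mathbf x)\,\delta(E-\phi(\mathbf x,\mathbf d,\mathbf s))\,d\mathbf x.$$ **Theorem.** Let $\mathcal X$ be a real Hilbert space, or more generally a real normed space, with a continuous linear map $\mathcal X\to L^\infty(\Omega)$ (for example, an embedded space of bounded functions, or $L^\infty(\Omega)$ itself); elements of $\mathcal X$ are identified with their images. 1. $\mathfrak L_1(f)$ is well defined as an element of $\mathcal Y$ for every $f\in\mathcal X$. 2. The maps $\mathfrak W_1:\mathcal X\to L^\infty(\Omega\times K;\,d\mathbf x\otimes d\nu)$ and $\mathfrak L_1:\mathcal X\to\mathcal Y$ are Fréchet differentiable at every $f\in\mathcal X$, and, for all $h\in\mathcal X$, $(\mathfrak W_1)'_f h=-\mathfrak W_1(f)\,\mathfrak X h$ and $$(\mathfrak L_1)'_f h(E,\mathbf d,\mathbf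 s)=\int_\Omega\bigl[(\mathfrak W_1)'_f h(\mathbf z,\mathbf d,\mathbf s)\,f(\mathbf z)+\mathfrak W_1(f)(\mathbf z,\mathbf d,\mathbf s)\,h(\mathbf z)\bigr]\,\delta(E-\phi(\mathbf z,\mathbf d,\mathbf s))\,d\mathbf z .$$ 3. For every essentially bounded $f\in L^2(\Omega)$ the last formula, with $(\mathfrak W_1)'_f h:=-\mathfrak W_1(f)\,\mathfrak X h$ for $h\in L^2(\Omega)$, defines a bounded linear operator $(\mathfrak L_1)'_f:L^2(\Omega)\to\mathcal Y$. -/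

import Mathlib

open MeasureTheory Set
open scoped ENNReal

noncomputable section

namespace ComptonScattering

/-- The space `ℝⁿ` with the Euclidean norm. -/
abbrev Vec (n : ℕ) : Type := EuclideanSpace ℝ (Fin n)

/-- The Compton formula: the energy of a photon of initial energy `E₀` after a scattering event
with scattering angle `ω`, where `mc2` is the energy of an electron at rest. -/
def comptonEnergy (E₀ mc2 ω : ℝ) : ℝ :=
  E₀ / (1 + E₀ / mc2 * (1 - Real.cos ω))

/-- The branch of the inverse cotangent with values in `(0, π)`. -/
def arccot (y : ℝ) : ℝ := Real.pi / 2 - Real.arctan y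

/-- `κ(x, d, s)`, the cosine of the angle between `x - s` and `d - s`. -/
def kappa {n : ℕ} (x d s : Vec n) : ℝ :=
  inner ℝ (x - s) (d - s) / (‖x - s‖ * ‖d - s‖)

/-- `ρ(x, d, s) = ‖x - s‖ / ‖d - s‖`. -/
def rho {n : ℕ} (x d s : Vec n) : ℝ := ‖x - s‖ / ‖d - s‖

/-- The level-set function `φ(x, d, s)`: the energy of a photon emitted at `s`, scattered at `x` and
detected at `d`. (On the line through `s` and `d`, a null set of points `x` in dimension `n ≥ 2`,
the value is irrelevant.) -/
def phase {n : ℕ} (E₀ mc2 : ℝ) (x d s : Vec n) : ℝ :=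
  comptonEnergy E₀ mc2 (arccot ((kappa x d s - rho x d s) / Real.sqrt (1 - kappa x d s ^ 2)))

/-- The integral, with respect to arc length, of `f` over the segment from `x` to `y`, where `f` is
given on `Ω` and extended by zero. -/
def segmentIntegral {n : ℕ} (Ω : Set (Vec n)) (f : Vec n → ℝ) (x y : Vec n) : ℝ :=
  ‖y - x‖ * ∫ t in (0 : ℝ)..1, Ω.indicator f (x + t • (y - x))

/-- The X-ray transform of `f` along the scattering path from `s` to `x` and from `x` to `d`,
as a function of `q = (x, (d, s))`. -/
def xray {n : ℕ} (Ω : Set (Vec n)) (f : Vec n → ℝ) (q : Vec n × (Vec n × Vec n)) : ℝ :=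
  segmentIntegral Ω f q.2.2 q.1 + segmentIntegral Ω f q.1 q.2.1

/-- The weight `W₁(f)(x, d, s) = C exp (-X f) / (‖x - s‖² ‖d - x‖²)`, with `q = (x, (d, s))`. -/
def weight {n : ℕ} (C : ℝ) (Ω : Set (Vec n)) (f : Vec n → ℝ)
    (q : Vec n × (Vec n × Vec n)) : ℝ :=
  C * Real.exp (-xray Ω f q) / (‖q.1 - q.2.2‖ ^ 2 * ‖q.2.1 - q.1‖ ^ 2)

/-- The function `-(X h) W₁(f)`; the theorem asserts that this is the Fréchet derivative
`(W₁)'_f h` of the weight. -/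
def weightDeriv {n : ℕ} (C : ℝ) (Ω : Set (Vec n)) (f h : Vec n → ℝ)
    (q : Vec n × (Vec n × Vec n)) : ℝ :=
  -(xray Ω h q) * weight C Ω f q

/-- The measure `dx ⊗ dν(d, s)` on `Ω × {(d, s)}`, with `ν` a measure on detector-source pairs. -/
abbrev objMeasure {n : ℕ} (Ω : Set (Vec n)) (ν : Measure (Vec n × Vec n)) :
    Measure (Vec n × (Vec n × Vec n)) :=
  ((volume : Measure (Vec n)).restrict Ω).prod ν

/-- The measure `dE ⊗ dν(d, s)` on `𝔼 × {(d, s)}`. -/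
abbrev dataMeasure {n : ℕ} (𝔼 : Set ℝ) (ν : Measure (Vec n × Vec n)) :
    Measure (ℝ × (Vec n × Vec n)) :=
  ((volume : Measure ℝ).restrict 𝔼).prod ν

/-- `u(E, d, s) = ∫_Ω g(x, d, s) δ(E - φ(x, d, s)) dx` for `E ∈ 𝔼`.
As usual for the delta distribution, this means that for all test functions `ψ`,
`∫∫_𝔼 u(E, d, s) ψ(E, d, s) dE dν(d, s) =
  ∫∫_{x ∈ Ω, φ(x, d, s) ∈ 𝔼} g(x, d, s) ψ(φ(x, d, s), d, s) dx dν(d, s)`. -/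
def IsDeltaIntegral {n : ℕ} (E₀ mc2 : ℝ) (Ω : Set (Vec n)) (𝔼 : Set ℝ)
    (ν : Measure (Vec n × Vec n)) (g : Vec n × (Vec n × Vec n) → ℝ)
    (u : ℝ × (Vec n × Vec n) → ℝ) : Prop :=
  Integrable g (objMeasure Ω ν) ∧ Integrable u (dataMeasure 𝔼 ν) ∧
    ∀ ψ : ℝ × (Vec n × Vec n) → ℝ, Measurable ψ → (∃ B : ℝ, ∀ p, |ψ p| ≤ B) →
      ∫ p, u p * ψ p ∂(dataMeasure 𝔼 ν) =
        ∫ q, g q * 𝔼.indicator (fun E => ψ (E, q.2)) (phase E₀ mc2 q.1 q.2.1 q.2.2)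
          ∂(objMeasure Ω ν)

/-- The delta integral of `g` is unique almost everywhere. -/
theorem IsDeltaIntegral.ae_eq {n : ℕ} {E₀ mc2 : ℝ} {Ω : Set (Vec n)} {𝔼 : Set ℝ}
    {ν : Measure (Vec n × Vec n)} {g : Vec n × (Vec n × Vec n) → ℝ}
    {u v : ℝ × (Vec n × Vec n) → ℝ} (hu : IsDeltaIntegral E₀ mc2 Ω 𝔼 ν g u)
    (hv : IsDeltaIntegral E₀ mc2 Ω 𝔼 ν g v) : u =ᵐ[dataMeasure 𝔼 ν] v := by
  refine Integrable.ae_eq_of_forall_setIntegral_eq u v hu.2.1 hv.2.1 fun A hA _ => ?_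
  have hψ : Measurable (A.indicator (fun _ => (1 : ℝ))) := measurable_const.indicator hA
  have hb : ∃ B : ℝ, ∀ p, |A.indicator (fun _ => (1 : ℝ)) p| ≤ B := by
    refine ⟨1, fun p => ?_⟩
    by_cases hp : p ∈ A <;> simp [hp]
  have key := (hu.2.2 _ hψ hb).trans (hv.2.2 _ hψ hb).symm
  have aux : ∀ w : ℝ × (Vec n × Vec n) → ℝ,
      (fun p => w p * A.indicator (fun _ => (1 : ℝ)) p) = A.indicator w := by
    intro w
    funext p
    by_cases hp : p ∈ A <;> simp [hp]
  rwa [aux, aux, integral_indicator hA, integral_indicator hA] at key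

open Classical in
/-- The element `(E, d, s) ↦ ∫_Ω g(x, d, s) δ(E - φ(x, d, s)) dx` of `L²(𝔼 × {(d, s)}; dE ⊗ dν)`,
with the value `0` if the delta integral of `g` is not represented by an element of this space. -/
def deltaIntegral {n : ℕ} (E₀ mc2 : ℝ) (Ω : Set (Vec n)) (𝔼 : Set ℝ)
    (ν : Measure (Vec n × Vec n)) (g : Vec n × (Vec n × Vec n) → ℝ) :
    Lp ℝ 2 (dataMeasure 𝔼 ν) :=
  if H : ∃ u : Lp ℝ 2 (dataMeasure 𝔼 ν), IsDeltaIntegral E₀ mc2 Ω 𝔼 ν g u then H.choose else 0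

theorem IsDeltaIntegral.deltaIntegral_eq {n : ℕ} {E₀ mc2 : ℝ} {Ω : Set (Vec n)} {𝔼 : Set ℝ}
    {ν : Measure (Vec n × Vec n)} {g : Vec n × (Vec n × Vec n) → ℝ}
    {u : Lp ℝ 2 (dataMeasure 𝔼 ν)} (hu : IsDeltaIntegral E₀ mc2 Ω 𝔼 ν g u) :
    deltaIntegral E₀ mc2 Ω 𝔼 ν g = u := by
  have H : ∃ u : Lp ℝ 2 (dataMeasure 𝔼 ν), IsDeltaIntegral E₀ mc2 Ω 𝔼 ν g u := ⟨u, hu⟩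
  rw [deltaIntegral, dif_pos H]
  exact Lp.ext (H.choose_spec.ae_eq hu)

/-- The integrand `W₁(f) f` of the first-order operator. -/
def integrand {n : ℕ} (C : ℝ) (Ω : Set (Vec n)) (f : Vec n → ℝ)
    (q : Vec n × (Vec n × Vec n)) : ℝ :=
  weight C Ω f q * f q.1

/-- The integrand `(W₁)'_f h · f + W₁(f) h` of the derivative. -/
def integrandDeriv {n : ℕ} (C : ℝ) (Ω : Set (Vec n)) (f h : Vec n → ℝ)
    (q : Vec n × (Vec n × Vec n)) : ℝ :=
  weightDeriv C Ω f h q * f q.1 + weight C Ω f q * h q.1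

/-- The nonlinear first-order Compton scattering operator
`L₁(f)(E, d, s) = ∫_Ω W₁(f)(x, d, s) f(x) δ(E - φ(x, d, s)) dx`. -/
def L1 {n : ℕ} (C E₀ mc2 : ℝ) (Ω : Set (Vec n)) (𝔼 : Set ℝ)
    (ν : Measure (Vec n × Vec n)) (f : Vec n → ℝ) : Lp ℝ 2 (dataMeasure 𝔼 ν) :=
  deltaIntegral E₀ mc2 Ω 𝔼 ν (integrand C Ω f)

end ComptonScattering

end

/-!
The delta integral `u(E, d, s) = ∫ g(x, d, s) δ(E - φ(x, d, s)) dx` is the adjoint of the substitution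
operator `ψ ↦ ψ(φ(x, d, s), d, s)`, restricted to energies in `𝔼`. Once this substitution is known to
be bounded from `L²(dE ⊗ dν)` to `L²(dx ⊗ dν)`, the delta integral is a bounded linear operator between
these spaces (`exists_deltaIntegral_operator`), and the nonlinear problem reduces to the integrand.

Boundedness of the substitution means that `{x ∈ Ω : φ(x, d, s) ∈ A}` has volume at most `M |A|` for
`A ⊆ 𝔼`, uniformly in `(d, s) ∈ K` (`volume_phase_mem_le`). On a ray `x = s + t (y - s)` the number `κ`
is constant and `ρ` is linear in `t`, so the cotangent `(κ - ρ) / √(1 - κ²)` of the scattering angle is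
affine in `t`, with slope bounded away from zero. It is a Lipschitz function of the energy on `𝔼`,
because `closure 𝔼` avoids the energies of forward and backward scattering. This gives the estimate on
each ray, and averaging over dilations with centre `s` gives it in space, without a coarea formula.

The same averaging controls line integrals: sources and detectors keep a positive distance from `Ω`, so
integration over segments from `s` or `d` is bounded from `L^p(Ω)` to `L^p(dx ⊗ dν)` for `p = 2` and
`p = ∞` (`lintegral_segment_le`, `exists_xray_operator_two`, `exists_xray_operator_top`). The weight is
then `Γ exp (-X f)` with `Γ ∈ L^∞` and `X` bounded and linear. The map `a ↦ exp (-a)` is Fréchet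
differentiable on `L^∞` (`hasFDerivAt_expNeg`), and the remaining claims follow from the chain rule, the
product rule for `L^∞ × L² → L²`, and the boundedness of the X-ray transform on `L²`.
-/

namespace ComptonScattering

/-! ### Line integrals over segments with a common endpoint -/

theorem lintegral_comp_homothety {n : ℕ} (c : Vec n) {t : ℝ} (ht : 0 < t) {G : Vec n → ℝ≥0∞}
    (hG : Measurable G) :
    ∫⁻ x, G (c + t • (x - c)) = ENNReal.ofReal ((t ^ n)⁻¹) * ∫⁻ x, G x := by
  have h1 : ∀ x : Vec n, c + t • (x - c) = t • x + (c - t • c) := by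
    intro x; rw [smul_sub]; abel
  simp_rw [h1]
  rw [← lintegral_map (μ := volume) (f := fun y : Vec n => G (y + (c - t • c)))
    (g := fun x => t • x) (by fun_prop) (by fun_prop)]
  rw [Measure.map_addHaar_smul _ ht.ne', lintegral_smul_measure,
    lintegral_add_right_eq_self (fun y => G y)]
  simp only [finrank_euclideanSpace, Fintype.card_fin, smul_eq_mul]
  rw [abs_of_pos (by positivity)]

/-- Averaging over all segments from `c` to points of `Ω` costs at most a factor `(R / δ)ⁿ`. For fixed
`t`, the substitution `y = c + t (x - c)` has Jacobian `tⁿ`, and only `t ≥ δ / R` contributes, because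
`Ω` keeps the distance `δ` from `c`. -/
theorem lintegral_segment_le {n : ℕ} {Ω : Set (Vec n)} (hΩ : MeasurableSet Ω) {c : Vec n}
    {δ R : ℝ} (hδ : 0 < δ) (hδR : δ ≤ R) (hc : ∀ x ∈ Ω, δ ≤ ‖x - c‖ ∧ ‖x - c‖ ≤ R)
    {G : Vec n → ℝ≥0∞} (hG : Measurable G) :
    ∫⁻ x in Ω, ∫⁻ t in Ioc (0 : ℝ) 1, Ω.indicator G (c + t • (x - c)) ≤
      ENNReal.ofReal ((R / δ) ^ n) * ∫⁻ x in Ω, G x := by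
  have hR : 0 < R := hδ.trans_le hδR
  have hm : Measurable (Ω.indicator G) := hG.indicator hΩ
  rw [lintegral_lintegral_swap (by fun_prop)]
  calc ∫⁻ t in Ioc (0 : ℝ) 1, ∫⁻ x in Ω, Ω.indicator G (c + t • (x - c))
      ≤ ∫⁻ t in Ioc (0 : ℝ) 1, ENNReal.ofReal ((R / δ) ^ n) * ∫⁻ x in Ω, G x := by
        refine setLIntegral_mono measurable_const fun t ht => ?_
        rcases lt_or_ge t (δ / R) with h | h
        · -- the points `c + t (x - c)` are closer to `c` than every point of `Ω`
          have : ∫⁻ x in Ω, Ω.indicator G (c + t • (x - c)) = 0 := by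
            rw [setLIntegral_congr_fun (g := fun _ => 0) hΩ, lintegral_zero]
            intro x hx
            refine indicator_of_notMem (fun hmem => ?_) _
            have h1 := (hc _ hmem).1
            rw [add_sub_cancel_left, norm_smul, Real.norm_of_nonneg ht.1.le] at h1
            have h2 : t * ‖x - c‖ ≤ t * R := mul_le_mul_of_nonneg_left (hc x hx).2 ht.1.le
            rw [lt_div_iff₀ hR] at h
            linarith
          rw [this]; exact zero_le
        · refine (setLIntegral_le_lintegral _ _).trans ?_
          rw [lintegral_comp_homothety c ht.1 hm, lintegral_indicator hΩ]
          gcongr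
          rw [← inv_pow]
          have := ht.1
          gcongr
          rw [← inv_div]
          gcongr
    _ ≤ _ := by simp

/-- A null set of `Ω` meets almost every segment from `c` in a null set. Hence line integrals of
functions defined almost everywhere make sense for almost every endpoint. -/
theorem ae_ae_segment {n : ℕ} {Ω : Set (Vec n)} (hΩ : MeasurableSet Ω) {c : Vec n}
    {δ R : ℝ} (hδ : 0 < δ) (hδR : δ ≤ R) (hc : ∀ x ∈ Ω, δ ≤ ‖x - c‖ ∧ ‖x - c‖ ≤ R)
    {P : Vec n → Prop} (hP : ∀ᵐ x ∂(volume : Measure (Vec n)).restrict Ω, P x) :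
    ∀ᵐ x ∂(volume : Measure (Vec n)).restrict Ω, ∀ᵐ t ∂(volume : Measure ℝ).restrict (Ioc 0 1),
      c + t • (x - c) ∈ Ω → P (c + t • (x - c)) := by
  obtain ⟨N, hPN, hN, hN0⟩ := exists_measurable_superset_of_null (ae_iff.mp hP)
  have hm : Measurable (N.indicator (fun _ => (1 : ℝ≥0∞))) := measurable_const.indicator hN
  have hm' := hm.indicator hΩ
  have key := lintegral_segment_le hΩ hδ hδR hc hm
  rw [lintegral_indicator_const hN, hN0, mul_zero, mul_zero, nonpos_iff_eq_zero,
    lintegral_eq_zero_iff (by fun_prop)] at key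
  filter_upwards [key] with x hx
  rw [Pi.zero_apply, lintegral_eq_zero_iff (by fun_prop)] at hx
  filter_upwards [hx] with t ht hmem
  by_contra hcon
  rw [indicator_of_mem hmem, indicator_of_mem (hPN hcon)] at ht
  exact one_ne_zero ht

theorem segmentIntegral_symm {n : ℕ} (Ω : Set (Vec n)) (f : Vec n → ℝ) (x y : Vec n) :
    segmentIntegral Ω f x y = segmentIntegral Ω f y x := by
  unfold segmentIntegral
  rw [norm_sub_rev]
  congr 1
  have := intervalIntegral.integral_comp_sub_left (a := 0) (b := 1)
    (fun t : ℝ => Ω.indicator f (y + t • (x - y))) 1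
  simp only [sub_self, sub_zero] at this
  rw [← this]
  congr 1
  funext t
  congr 1
  rw [sub_smul, one_smul, smul_sub, smul_sub]
  abel

theorem xray_eq {n : ℕ} (Ω : Set (Vec n)) (f : Vec n → ℝ) (q : Vec n × (Vec n × Vec n)) :
    xray Ω f q = segmentIntegral Ω f q.2.2 q.1 + segmentIntegral Ω f q.2.1 q.1 := by
  rw [xray, segmentIntegral_symm Ω f q.1]

theorem measurable_segmentIntegral {n : ℕ} {Ω : Set (Vec n)} (hΩ : MeasurableSet Ω)
    {f : Vec n → ℝ} (hf : StronglyMeasurable f) :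
    Measurable (fun p : Vec n × Vec n => segmentIntegral Ω f p.1 p.2) := by
  unfold segmentIntegral
  refine Measurable.mul (by fun_prop) ?_
  simp_rw [intervalIntegral.integral_of_le zero_le_one]
  have hm : Measurable (Ω.indicator f) := hf.measurable.indicator hΩ
  have : StronglyMeasurable (Function.uncurry fun (p : Vec n × Vec n) (t : ℝ) =>
      Ω.indicator f (p.1 + t • (p.2 - p.1))) := by
    refine Measurable.stronglyMeasurable ?_
    unfold Function.uncurry
    fun_prop
  exact this.integral_prod_right.measurable

theorem segmentIntegral_congr_ae {n : ℕ} {Ω : Set (Vec n)} (hΩ : MeasurableSet Ω) {c : Vec n}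
    {δ R : ℝ} (hδ : 0 < δ) (hδR : δ ≤ R) (hc : ∀ x ∈ Ω, δ ≤ ‖x - c‖ ∧ ‖x - c‖ ≤ R)
    {f g : Vec n → ℝ} (hfg : f =ᵐ[(volume : Measure (Vec n)).restrict Ω] g) :
    ∀ᵐ x ∂(volume : Measure (Vec n)).restrict Ω,
      segmentIntegral Ω f c x = segmentIntegral Ω g c x := by
  filter_upwards [ae_ae_segment hΩ hδ hδR hc hfg] with x hx
  unfold segmentIntegral
  simp_rw [intervalIntegral.integral_of_le zero_le_one]
  congr 1
  refine integral_congr_ae ?_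
  filter_upwards [hx] with t ht
  by_cases h : c + t • (x - c) ∈ Ω
  · simp [h, ht h]
  · simp [h]

theorem abs_segmentIntegral_le_ae {n : ℕ} {Ω : Set (Vec n)} (hΩ : MeasurableSet Ω) {c : Vec n}
    {δ R : ℝ} (hδ : 0 < δ) (hδR : δ ≤ R) (hc : ∀ x ∈ Ω, δ ≤ ‖x - c‖ ∧ ‖x - c‖ ≤ R)
    {f : Vec n → ℝ} {B : ℝ} (hB : 0 ≤ B)
    (hf : ∀ᵐ x ∂(volume : Measure (Vec n)).restrict Ω, |f x| ≤ B) :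
    ∀ᵐ x ∂(volume : Measure (Vec n)).restrict Ω, |segmentIntegral Ω f c x| ≤ R * B := by
  filter_upwards [ae_ae_segment hΩ hδ hδR hc hf, ae_restrict_mem hΩ] with x hx hxΩ
  unfold segmentIntegral
  rw [abs_mul, abs_norm, intervalIntegral.integral_of_le zero_le_one]
  have h : |∫ t in Ioc (0 : ℝ) 1, Ω.indicator f (c + t • (x - c))| ≤ B := by
    have := norm_integral_le_of_norm_le_const (μ := (volume : Measure ℝ).restrict (Ioc 0 1))
      (f := fun t => Ω.indicator f (c + t • (x - c))) (C := B) (by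
        filter_upwards [hx] with t ht
        by_cases h : c + t • (x - c) ∈ Ω
        · simpa [h] using ht h
        · simpa [h] using hB)
    simpa using this
  exact mul_le_mul (hc x hxΩ).2 h (abs_nonneg _) (hδ.le.trans hδR)

theorem integrableOn_segment_ae {n : ℕ} {Ω : Set (Vec n)} (hΩ : MeasurableSet Ω) {c : Vec n}
    {δ R : ℝ} (hδ : 0 < δ) (hδR : δ ≤ R) (hc : ∀ x ∈ Ω, δ ≤ ‖x - c‖ ∧ ‖x - c‖ ≤ R)
    {f : Vec n → ℝ} (hfm : StronglyMeasurable f) (hf : IntegrableOn f Ω) :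
    ∀ᵐ x ∂(volume : Measure (Vec n)).restrict Ω,
      IntegrableOn (fun t : ℝ => Ω.indicator f (c + t • (x - c))) (Ioc 0 1) := by
  have hm : Measurable (Ω.indicator f) := hfm.measurable.indicator hΩ
  have hm' : Measurable (Ω.indicator fun x => ‖f x‖ₑ) := hfm.measurable.enorm.indicator hΩ
  have key := lintegral_segment_le hΩ hδ hδR hc (G := fun x => ‖f x‖ₑ) hfm.measurable.enorm
  have hlt := key.trans_lt (ENNReal.mul_lt_top ENNReal.ofReal_lt_top hf.2)
  filter_upwards [ae_lt_top (by fun_prop) hlt.ne] with x hx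
  refine ⟨(by fun_prop : Measurable _).aestronglyMeasurable, ?_⟩
  simpa only [HasFiniteIntegral, enorm_indicator_eq_indicator_enorm] using hx

theorem segmentIntegral_add_ae {n : ℕ} {Ω : Set (Vec n)} (hΩ : MeasurableSet Ω) {c : Vec n}
    {δ R : ℝ} (hδ : 0 < δ) (hδR : δ ≤ R) (hc : ∀ x ∈ Ω, δ ≤ ‖x - c‖ ∧ ‖x - c‖ ≤ R)
    {f g : Vec n → ℝ} (hfm : StronglyMeasurable f) (hf : IntegrableOn f Ω)
    (hgm : StronglyMeasurable g) (hg : IntegrableOn g Ω) :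
    ∀ᵐ x ∂(volume : Measure (Vec n)).restrict Ω,
      segmentIntegral Ω (f + g) c x = segmentIntegral Ω f c x + segmentIntegral Ω g c x := by
  filter_upwards [integrableOn_segment_ae hΩ hδ hδR hc hfm hf,
    integrableOn_segment_ae hΩ hδ hδR hc hgm hg] with x hfx hgx
  unfold segmentIntegral
  simp_rw [intervalIntegral.integral_of_le zero_le_one]
  rw [← mul_add, ← integral_add hfx hgx]
  simp_rw [indicator_add', Pi.add_apply]

theorem segmentIntegral_smul {n : ℕ} (Ω : Set (Vec n)) (a : ℝ) (f : Vec n → ℝ) (x y : Vec n) :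
    segmentIntegral Ω (a • f) x y = a * segmentIntegral Ω f x y := by
  unfold segmentIntegral
  rw [show Ω.indicator (a • f) = fun x => a * Ω.indicator f x from ?_,
    intervalIntegral.integral_const_mul]
  · ring
  · funext x
    by_cases h : x ∈ Ω <;> simp [h]

/-- The integral over `(0, 1]` satisfies `(∫ g)² ≤ ∫ g²`. -/
theorem enorm_integral_Ioc_sq_le {g : ℝ → ℝ} (hg : Measurable g) :
    ‖∫ t in Ioc (0 : ℝ) 1, g t‖ₑ ^ (2 : ℝ) ≤ ∫⁻ t in Ioc (0 : ℝ) 1, ‖g t‖ₑ ^ (2 : ℝ) := by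
  have h1 : ‖∫ t in Ioc (0 : ℝ) 1, g t‖ₑ ≤ eLpNorm g 1 (volume.restrict (Ioc (0 : ℝ) 1)) := by
    rw [eLpNorm_one_eq_lintegral_enorm]
    exact enorm_integral_le_lintegral_enorm _
  have : IsProbabilityMeasure (volume.restrict (Ioc (0 : ℝ) 1)) := ⟨by simp⟩
  have h2 := eLpNorm_le_eLpNorm_of_exponent_le (p := 1) (q := 2) (by norm_num)
    (hg.aestronglyMeasurable (μ := volume.restrict (Ioc (0 : ℝ) 1)))
  have h3 := ENNReal.rpow_le_rpow (h1.trans h2) (zero_le_two (α := ℝ))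
  rw [eLpNorm_eq_lintegral_rpow_enorm_toReal (by norm_num) (by norm_num), ← ENNReal.rpow_mul] at h3
  simpa using h3

theorem lintegral_segmentIntegral_sq_le {n : ℕ} {Ω : Set (Vec n)} (hΩ : MeasurableSet Ω)
    {c : Vec n} {δ R : ℝ} (hδ : 0 < δ) (hδR : δ ≤ R)
    (hc : ∀ x ∈ Ω, δ ≤ ‖x - c‖ ∧ ‖x - c‖ ≤ R) {f : Vec n → ℝ} (hf : StronglyMeasurable f) :
    ∫⁻ x in Ω, ‖segmentIntegral Ω f c x‖ₑ ^ (2 : ℝ) ≤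
      ENNReal.ofReal R ^ (2 : ℝ) * ENNReal.ofReal ((R / δ) ^ n) *
        ∫⁻ x in Ω, ‖f x‖ₑ ^ (2 : ℝ) := by
  have hm : Measurable (Ω.indicator f) := hf.measurable.indicator hΩ
  have hm2 : Measurable fun x => ‖f x‖ₑ ^ (2 : ℝ) := hf.measurable.enorm.pow_const _
  have hm3 := hm2.indicator hΩ
  have hind : ∀ y, ‖Ω.indicator f y‖ₑ ^ (2 : ℝ) = Ω.indicator (fun x => ‖f x‖ₑ ^ (2 : ℝ)) y := by
    intro y
    by_cases h : y ∈ Ω <;> simp [h]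
  rw [mul_assoc]
  refine le_trans ?_ (mul_le_mul_right (lintegral_segment_le hΩ hδ hδR hc hm2) _)
  rw [← lintegral_const_mul _ (by fun_prop)]
  refine setLIntegral_mono (by fun_prop) fun x hx => ?_
  unfold segmentIntegral
  rw [enorm_mul, ENNReal.mul_rpow_of_nonneg _ _ zero_le_two,
    intervalIntegral.integral_of_le zero_le_one]
  refine mul_le_mul' ?_ ?_
  · rw [enorm_norm, ← ofReal_norm]
    gcongr
    exact (hc x hx).2
  · simp_rw [← hind]
    exact enorm_integral_Ioc_sq_le (by fun_prop)

/-! ### Level sets of the phase -/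

/-- The inverse of `y ↦ comptonEnergy E₀ mc2 (arccot y)`: the cotangent of the scattering angle of
a photon detected with energy `E`. -/
noncomputable def comptonCot (E₀ mc2 E : ℝ) : ℝ :=
  (1 - (E₀ / E - 1) * (mc2 / E₀)) / Real.sqrt (1 - (1 - (E₀ / E - 1) * (mc2 / E₀)) ^ 2)

theorem cos_arccot (y : ℝ) : Real.cos (arccot y) = y / Real.sqrt (1 + y ^ 2) := by
  rw [arccot, Real.cos_pi_div_two_sub, Real.sin_arctan]

/-- From the energy `E`, the Compton formula recovers the cosine of the scattering angle as
`1 - (E₀ / E - 1) mc² / E₀`, and hence its cotangent. -/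
theorem comptonCot_comptonEnergy {E₀ mc2 : ℝ} (hE₀ : 0 < E₀) (hmc2 : 0 < mc2) (y : ℝ) :
    comptonCot E₀ mc2 (comptonEnergy E₀ mc2 (arccot y)) = y := by
  have hs : 0 < Real.sqrt (1 + y ^ 2) := by positivity
  have hs2 : Real.sqrt (1 + y ^ 2) ^ 2 = 1 + y ^ 2 := Real.sq_sqrt (by positivity)
  have hc := Real.cos_le_one (arccot y)
  have hd : 0 < 1 + E₀ / mc2 * (1 - Real.cos (arccot y)) := by
    have : 0 ≤ E₀ / mc2 * (1 - Real.cos (arccot y)) :=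
      mul_nonneg (by positivity) (by linarith)
    linarith
  have h1 : 1 - (E₀ / comptonEnergy E₀ mc2 (arccot y) - 1) * (mc2 / E₀)
      = y / Real.sqrt (1 + y ^ 2) := by
    rw [← cos_arccot, comptonEnergy, div_div_cancel₀ hE₀.ne']
    field_simp
    ring
  have h2 : 1 - (y / Real.sqrt (1 + y ^ 2)) ^ 2 = (Real.sqrt (1 + y ^ 2))⁻¹ ^ 2 := by
    rw [div_pow, inv_pow, hs2]
    field_simp
    ring
  rw [comptonCot, h1, h2, Real.sqrt_sq (by positivity)]
  field_simp

/-- Only forward and backward scattering are singular, and `closure 𝔼` is a compact set of energies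
that excludes both. -/
theorem exists_lipschitzOnWith_comptonCot {E₀ mc2 : ℝ} (hE₀ : 0 < E₀) (hmc2 : 0 < mc2)
    {𝔼 : Set ℝ} (h𝔼c : closure 𝔼 ⊆ Ioo (comptonEnergy E₀ mc2 Real.pi) E₀) :
    ∃ k, LipschitzOnWith k (comptonCot E₀ mc2) 𝔼 := by
  have hcpt : IsCompact (closure 𝔼) :=
    (Metric.isBounded_Ioo _ _).subset h𝔼c |>.isCompact_closure |> fun h => by simpa using h
  -- on the open interval of energies the cosine stays in `(-1, 1)`, where `comptonCot` is smooth
  have hloc : LocallyLipschitzOn (closure 𝔼) (comptonCot E₀ mc2) := by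
    intro E hE
    have hE' := h𝔼c hE
    have hπ : comptonEnergy E₀ mc2 Real.pi = E₀ / (1 + 2 * (E₀ / mc2)) := by
      rw [comptonEnergy, Real.cos_pi]; ring_nf
    rw [hπ] at hE'
    have hEpos : 0 < E := lt_trans (by positivity) hE'.1
    have hb1 : (E₀ / E - 1) * (mc2 / E₀) < 2 := by
      have h1 := hE'.1
      rw [div_lt_iff₀ (by positivity)] at h1
      have h2 : E₀ / E < 1 + 2 * (E₀ / mc2) := by
        rw [div_lt_iff₀ hEpos]; linarith
      calc (E₀ / E - 1) * (mc2 / E₀) < (2 * (E₀ / mc2)) * (mc2 / E₀) := by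
            gcongr; linarith
        _ = 2 := by field_simp
    have hb0 : 0 < (E₀ / E - 1) * (mc2 / E₀) := by
      have : 1 < E₀ / E := by rw [one_lt_div hEpos]; exact hE'.2
      exact mul_pos (by linarith) (by positivity)
    have hpos : 0 < 1 - (1 - (E₀ / E - 1) * (mc2 / E₀)) ^ 2 := by nlinarith
    have hsm : ContDiffAt ℝ 1 (fun E : ℝ => 1 - (E₀ / E - 1) * (mc2 / E₀)) E := by
      have := hEpos.ne'
      fun_prop (disch := assumption)
    have hcd : ContDiffAt ℝ 1 (comptonCot E₀ mc2) E := by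
      unfold comptonCot
      refine hsm.div ((contDiffAt_const.sub (hsm.pow 2)).sqrt hpos.ne') ?_
      exact (Real.sqrt_pos.mpr hpos).ne'
    obtain ⟨k, t, ht, hk⟩ := hcd.exists_lipschitzOnWith
    exact ⟨k, t, mem_nhdsWithin_of_mem_nhds ht, hk⟩
  obtain ⟨k, hk⟩ := hloc.exists_lipschitzOnWith_of_compact hcpt
  exact ⟨k, hk.mono subset_closure⟩

theorem measurable_phase {n : ℕ} (E₀ mc2 : ℝ) :
    Measurable fun q : Vec n × (Vec n × Vec n) => phase E₀ mc2 q.1 q.2.1 q.2.2 := by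
  unfold phase comptonEnergy arccot kappa rho
  fun_prop

theorem kappa_segment {n : ℕ} (x d s : Vec n) {t : ℝ} (ht : 0 < t) :
    kappa (s + t • (x - s)) d s = kappa x d s := by
  unfold kappa
  rw [add_sub_cancel_left, real_inner_smul_left, norm_smul, Real.norm_of_nonneg ht.le, mul_assoc,
    mul_div_mul_left _ _ ht.ne']

theorem rho_segment {n : ℕ} (x d s : Vec n) {t : ℝ} (ht : 0 < t) :
    rho (s + t • (x - s)) d s = t * rho x d s := by
  unfold rho
  rw [add_sub_cancel_left, norm_smul, Real.norm_of_nonneg ht.le, mul_div_assoc]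

/-- In dimension at least two the line through `s` and `d` is a null set. -/
theorem abs_kappa_lt_one_ae {n : ℕ} (hn : 2 ≤ n) (d s : Vec n) :
    ∀ᵐ x : Vec n, |kappa x d s| < 1 := by
  have hne : AffineSubspace.mk' s (Submodule.span ℝ {d - s}) ≠ ⊤ := by
    intro h
    have h1 : Submodule.span ℝ {d - s} = ⊤ := by
      rw [← AffineSubspace.direction_mk' s (Submodule.span ℝ {d - s}), h,
        AffineSubspace.direction_top]
    have h2 := finrank_span_le_card (R := ℝ) ({d - s} : Set (Vec n))
    rw [h1, finrank_top] at h2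
    simp at h2
    omega
  have h0 := Measure.addHaar_affineSubspace (volume : Measure (Vec n)) _ hne
  filter_upwards [measure_eq_zero_iff_ae_notMem.mp h0] with x hx
  refine lt_of_le_of_ne (abs_real_inner_div_norm_mul_norm_le_one _ _) fun h => hx ?_
  obtain ⟨hxs, r, hr, hd⟩ := (abs_real_inner_div_norm_mul_norm_eq_one_iff _ _).mp h
  rw [SetLike.mem_coe, AffineSubspace.mem_mk', Submodule.mem_span_singleton]
  exact ⟨r⁻¹, by rw [hd, inv_smul_smul₀ hr, vsub_eq_sub]⟩

/-- On the ray `t ↦ s + t (x - s)` the set of `t` where `φ` lies in `A` is contained in the image of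
`A` under a Lipschitz map, because `(κ - t ρ) / √(1 - κ²)`, the cotangent of the scattering angle, is
affine in `t` and its slope is bounded away from zero. -/
theorem volume_segment_phase_le {n : ℕ} {E₀ mc2 : ℝ} (hE₀ : 0 < E₀) (hmc2 : 0 < mc2)
    {𝔼 : Set ℝ} {k : NNReal} (hk : LipschitzOnWith k (comptonCot E₀ mc2) 𝔼) {A : Set ℝ}
    (hA : A ⊆ 𝔼) {x d s : Vec n} (hx : |kappa x d s| < 1) {r : NNReal} (hr : 0 < r)
    (hrx : r ≤ rho x d s) :
    volume {t : ℝ | 0 < t ∧ phase E₀ mc2 (s + t • (x - s)) d s ∈ A} ≤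
      (k / r : NNReal) * volume A := by
  have hρ : 0 < rho x d s := lt_of_lt_of_le (by exact_mod_cast hr) hrx
  have hκ : 0 < 1 - kappa x d s ^ 2 := by
    have := (sq_lt_one_iff_abs_lt_one _).mpr hx
    linarith
  set σ := Real.sqrt (1 - kappa x d s ^ 2) with hσ
  have hσ0 : 0 < σ := Real.sqrt_pos.mpr hκ
  have hσ1 : σ ≤ 1 := by
    rw [hσ]
    exact Real.sqrt_le_one.mpr (by nlinarith [sq_nonneg (kappa x d s)])
  -- along the ray the cotangent of the scattering angle is affine in `t`
  have hsub : {t : ℝ | 0 < t ∧ phase E₀ mc2 (s + t • (x - s)) d s ∈ A} ⊆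
      (fun E => (kappa x d s - σ * comptonCot E₀ mc2 E) / rho x d s) '' A := by
    rintro t ⟨ht, htA⟩
    refine ⟨_, htA, ?_⟩
    simp only [phase]
    rw [comptonCot_comptonEnergy hE₀ hmc2, kappa_segment _ _ _ ht, rho_segment _ _ _ ht, ← hσ]
    field_simp
    ring
  have hlip : LipschitzOnWith (k / r)
      (fun E => (kappa x d s - σ * comptonCot E₀ mc2 E) / rho x d s) A := by
    refine LipschitzOnWith.of_dist_le_mul fun E hE E' hE' => ?_
    have h1 := hk.dist_le_mul E (hA hE) E' (hA hE')
    rw [Real.dist_eq] at h1 ⊢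
    have h2 : (kappa x d s - σ * comptonCot E₀ mc2 E) / rho x d s -
        (kappa x d s - σ * comptonCot E₀ mc2 E') / rho x d s =
        -(σ * (comptonCot E₀ mc2 E - comptonCot E₀ mc2 E') / rho x d s) := by ring
    rw [h2, abs_neg, abs_div, abs_mul, abs_of_pos hσ0, abs_of_pos hρ, NNReal.coe_div,
      div_mul_eq_mul_div]
    refine div_le_div₀ (by positivity) ?_ (by exact_mod_cast hr) hrx
    calc σ * |comptonCot E₀ mc2 E - comptonCot E₀ mc2 E'| ≤ 1 * (k * dist E E') := by
          gcongr
      _ = _ := one_mul _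
  have := hlip.hausdorffMeasure_image_le (d := 1) zero_le_one
  rw [hausdorffMeasure_real] at this
  refine (measure_mono hsub).trans (this.trans (le_of_eq ?_))
  simp

/-- The pushforward of Lebesgue measure on `Ω` under `φ(·, d, s)` has a density on `𝔼` that is bounded
uniformly in `(d, s)`. This replaces the coarea formula: the one-dimensional estimate along rays from
`s` is integrated over all rays by averaging over dilates of `Ω` with centre `s`. -/
theorem volume_phase_mem_le {n : ℕ} (hn : 2 ≤ n) {E₀ mc2 : ℝ} (hE₀ : 0 < E₀) (hmc2 : 0 < mc2)
    {𝔼 : Set ℝ} {k : NNReal} (hk : LipschitzOnWith k (comptonCot E₀ mc2) 𝔼)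
    {Ω : Set (Vec n)} (hΩ : MeasurableSet Ω) {d s : Vec n} (hds : d ≠ s)
    {δ R : NNReal} (hδ : 0 < δ) (hR : 0 < R) (hc : ∀ x ∈ Ω, δ ≤ ‖x - s‖ ∧ ‖x - s‖ ≤ R)
    (hdsR : ‖d - s‖ ≤ R) {A : Set ℝ} (hA : A ⊆ 𝔼) (hAm : MeasurableSet A) :
    volume (Ω ∩ {x | phase E₀ mc2 x d s ∈ A}) ≤
      2 * volume (Metric.closedBall (0 : Vec n) (2 * R)) * (k / (δ / R) : NNReal) * volume A := by
  have hph : Measurable fun x : Vec n => phase E₀ mc2 x d s :=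
    (measurable_phase E₀ mc2).comp (g := fun q : Vec n × (Vec n × Vec n) =>
      phase E₀ mc2 q.1 q.2.1 q.2.2) (f := fun x => (x, (d, s))) (by fun_prop)
  set S : Set (Vec n) := Ω ∩ {x | phase E₀ mc2 x d s ∈ A} with hS
  have hSm : MeasurableSet S := hΩ.inter (hph hAm)
  have hG : Measurable (S.indicator (1 : Vec n → ℝ≥0∞)) := measurable_one.indicator hSm
  have hL : 0 < ‖d - s‖ := norm_pos_iff.mpr (sub_ne_zero.mpr hds)
  -- the preimage of `S` under the dilation by `t ≤ 1` has at least the volume of `S`; restricting to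
  -- `t ≥ 1 / 2` keeps the relevant `x` in a ball of radius `2 R`
  have h1 : volume S * 2⁻¹ ≤
      ∫⁻ t in Ioc (1 / 2 : ℝ) 1, ∫⁻ x, S.indicator (1 : Vec n → ℝ≥0∞) (s + t • (x - s)) := by
    have hvol : volume (Ioc (1 / 2 : ℝ) 1) = 2⁻¹ := by
      rw [Real.volume_Ioc, show (1 : ℝ) - 1 / 2 = 2⁻¹ by norm_num,
        ENNReal.ofReal_inv_of_pos two_pos]
      simp
    rw [← hvol, ← setLIntegral_const]
    refine setLIntegral_mono' measurableSet_Ioc fun t ht => ?_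
    have ht0 : 0 < t := lt_trans (by norm_num) ht.1
    rw [lintegral_comp_homothety s ht0 hG, lintegral_indicator_one hSm]
    refine le_mul_of_one_le_left' ?_
    rw [ENNReal.one_le_ofReal]
    exact (one_le_inv₀ (by positivity)).mpr (pow_le_one₀ ht0.le ht.2)
  have h2 : ∫⁻ x, ∫⁻ t in Ioc (1 / 2 : ℝ) 1,
      S.indicator (1 : Vec n → ℝ≥0∞) (s + t • (x - s)) ≤
      ∫⁻ x, (Metric.closedBall s (2 * R)).indicator
        (fun _ => ((k / (δ / R) : NNReal) : ℝ≥0∞) * volume A) x := by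
    refine lintegral_mono_ae ?_
    filter_upwards [abs_kappa_lt_one_ae hn d s] with x hx
    by_cases hex : ∃ t ∈ Ioc (1 / 2 : ℝ) 1, s + t • (x - s) ∈ S
    · obtain ⟨t, ht, htS⟩ := hex
      have ht0 : 0 < t := lt_trans (by norm_num) ht.1
      have hb := hc _ htS.1
      rw [add_sub_cancel_left, norm_smul, Real.norm_of_nonneg ht0.le] at hb
      have hxR : ‖x - s‖ ≤ 2 * R := by nlinarith [ht.1, norm_nonneg (x - s)]
      have hxδ : δ ≤ ‖x - s‖ := by nlinarith [ht.2, norm_nonneg (x - s)]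
      rw [indicator_of_mem (by rwa [Metric.mem_closedBall, dist_eq_norm])]
      refine le_trans ?_ (volume_segment_phase_le hE₀ hmc2 hk hA hx (div_pos hδ hR) ?_)
      · have hcomp : (fun t : ℝ => S.indicator (1 : Vec n → ℝ≥0∞) (s + t • (x - s))) =
            {t : ℝ | s + t • (x - s) ∈ S}.indicator 1 := by
          funext t; simp [indicator]
        have hmeas : MeasurableSet {t : ℝ | s + t • (x - s) ∈ S} :=
          (by fun_prop : Measurable fun t : ℝ => s + t • (x - s)) hSm
        rw [hcomp, lintegral_indicator_one hmeas, Measure.restrict_apply hmeas]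
        refine measure_mono fun t ht => ⟨lt_trans (by norm_num) ht.2.1, ht.1.2⟩
      · rw [rho, NNReal.coe_div]
        exact div_le_div₀ (norm_nonneg _) hxδ hL hdsR
    · push Not at hex
      refine le_trans (le_of_eq ?_) zero_le
      rw [setLIntegral_congr_fun (g := fun _ => 0) measurableSet_Ioc, lintegral_zero]
      exact fun t ht => indicator_of_notMem (hex t ht) _
  rw [lintegral_lintegral_swap (by fun_prop)] at h1
  have h3 := h1.trans h2
  rw [lintegral_indicator_const Metric.isClosed_closedBall.measurableSet,
    Measure.addHaar_closedBall_center] at h3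
  calc volume S = 2 * (volume S * 2⁻¹) := by
        rw [mul_comm, mul_assoc, ENNReal.inv_mul_cancel two_ne_zero ENNReal.ofNat_ne_top, mul_one]
    _ ≤ 2 * (((k / (δ / R) : NNReal) : ℝ≥0∞) * volume A *
          volume (Metric.closedBall (0 : Vec n) (2 * R))) := by gcongr
    _ = _ := by ring

/-! ### Operators defined almost everywhere, and the geometry of the measurement -/

/-- A map `T` on functions that respects equality almost everywhere, is additive almost everywhere on
`L^p` and satisfies a norm estimate induces a bounded operator from `L^p` to `L^q`. -/
theorem exists_continuousLinearMap_Lp {α β : Type*} [MeasurableSpace α] [MeasurableSpace β]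
    {μ : Measure α} {ν : Measure β} {p q : ℝ≥0∞} [Fact (1 ≤ p)] [Fact (1 ≤ q)]
    (T : (α → ℝ) → β → ℝ) (M : NNReal)
    (hmeas : ∀ f : α → ℝ, StronglyMeasurable f → AEStronglyMeasurable (T f) ν)
    (hbound : ∀ f : α → ℝ, StronglyMeasurable f → MemLp f p μ →
      eLpNorm (T f) q ν ≤ M * eLpNorm f p μ)
    (hcongr : ∀ f g : α → ℝ, StronglyMeasurable f → StronglyMeasurable g →
      f =ᵐ[μ] g → T f =ᵐ[ν] T g)
    (hadd : ∀ f g : α → ℝ, StronglyMeasurable f → StronglyMeasurable g → MemLp f p μ →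
      MemLp g p μ → T (f + g) =ᵐ[ν] T f + T g)
    (hsmul : ∀ (a : ℝ) (f : α → ℝ), T (a • f) = a • T f) :
    ∃ L : Lp ℝ p μ →L[ℝ] Lp ℝ q ν, ∀ f : Lp ℝ p μ, L f =ᵐ[ν] T f := by
  have hmem : ∀ f : Lp ℝ p μ, MemLp (T f) q ν := fun f =>
    ⟨hmeas f (Lp.stronglyMeasurable f), (hbound f (Lp.stronglyMeasurable f) (Lp.memLp f)).trans_lt
      (ENNReal.mul_lt_top ENNReal.coe_lt_top (Lp.eLpNorm_lt_top f))⟩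
  refine ⟨LinearMap.mkContinuous
    { toFun := fun f => (hmem f).toLp (T f)
      map_add' := fun f g => ?_
      map_smul' := fun a f => ?_ } M fun f => ?_, fun f => (hmem f).coeFn_toLp⟩
  · rw [← MemLp.toLp_add]
    refine MemLp.toLp_congr _ _ ?_
    have hf := Lp.stronglyMeasurable f
    have hg := Lp.stronglyMeasurable g
    exact (hcongr _ _ (Lp.stronglyMeasurable _) (hf.add hg) (Lp.coeFn_add f g)).trans
      (hadd f g hf hg (Lp.memLp f) (Lp.memLp g))
  · rw [RingHom.id_apply, ← MemLp.toLp_const_smul]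
    refine MemLp.toLp_congr _ _ ?_
    refine (hcongr _ _ (Lp.stronglyMeasurable _) ((Lp.stronglyMeasurable f).const_smul a)
      (Lp.coeFn_smul a f)).trans ?_
    rw [hsmul]
  · change ‖(hmem f).toLp (T f)‖ ≤ M * ‖f‖
    rw [Lp.norm_toLp, Lp.norm_def, ← ENNReal.coe_toReal M, ← ENNReal.toReal_mul]
    exact ENNReal.toReal_mono (ENNReal.mul_ne_top ENNReal.coe_ne_top (Lp.eLpNorm_ne_top f))
      (hbound f (Lp.stronglyMeasurable f) (Lp.memLp f))

/-- The detectors and sources of the pairs in `K` keep a distance of at least `δ` and at most `R`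
from all points of `Ω`, and detector and source are distinct and at most `R` apart. -/
structure Separated {n : ℕ} (Ω : Set (Vec n)) (K : Set (Vec n × Vec n)) (δ R : NNReal) : Prop where
  pos : 0 < δ
  le : δ ≤ R
  detector : ∀ p ∈ K, ∀ x ∈ Ω, δ ≤ ‖x - p.1‖ ∧ ‖x - p.1‖ ≤ R
  source : ∀ p ∈ K, ∀ x ∈ Ω, δ ≤ ‖x - p.2‖ ∧ ‖x - p.2‖ ≤ R
  ne : ∀ p ∈ K, p.1 ≠ p.2
  baseline : ∀ p ∈ K, ‖p.1 - p.2‖ ≤ R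

theorem exists_separated {n : ℕ} {Ω : Set (Vec n)} (hΩb : Bornology.IsBounded Ω)
    {K : Set (Vec n × Vec n)} (hK : IsCompact K)
    (hKΩ : ∀ p ∈ K, p.1 ≠ p.2 ∧ p.1 ∉ closure Ω ∧ p.2 ∉ closure Ω) :
    ∃ δ R : NNReal, Separated Ω K δ R := by
  have hK1 : IsCompact (Prod.fst '' K) := hK.image continuous_fst
  have hK2 : IsCompact (Prod.snd '' K) := hK.image continuous_snd
  have hU : IsCompact (Prod.fst '' K ∪ Prod.snd '' K) := hK1.union hK2
  have hdisj : Disjoint (Prod.fst '' K ∪ Prod.snd '' K) (closure Ω) := by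
    rw [disjoint_left]
    rintro c (⟨p, hp, rfl⟩ | ⟨p, hp, rfl⟩)
    · exact (hKΩ p hp).2.1
    · exact (hKΩ p hp).2.2
  obtain ⟨δ, hδ, hδ'⟩ := Metric.exists_pos_forall_lt_edist hU isClosed_closure hdisj
  obtain ⟨r, hr⟩ := Metric.isBounded_iff_nndist.mp (hΩb.union hU.isBounded)
  have hlow : ∀ c ∈ Prod.fst '' K ∪ Prod.snd '' K, ∀ x ∈ Ω, (δ : ℝ) ≤ ‖x - c‖ := by
    intro c hc x hx
    have h := (hδ' c hc x (subset_closure hx)).le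
    rw [edist_nndist, ENNReal.coe_le_coe] at h
    rw [← dist_eq_norm, dist_comm, ← coe_nndist]
    exact_mod_cast h
  have hup : ∀ c ∈ Ω ∪ (Prod.fst '' K ∪ Prod.snd '' K), ∀ x ∈ Ω ∪ (Prod.fst '' K ∪ Prod.snd '' K),
      ‖x - c‖ ≤ (max δ r : NNReal) := by
    intro c hc x hx
    rw [← dist_eq_norm, ← coe_nndist]
    exact_mod_cast (hr hx hc).trans (le_max_right _ _)
  have h1 : ∀ p ∈ K, p.1 ∈ Prod.fst '' K ∪ Prod.snd '' K := fun p hp =>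
    Or.inl (mem_image_of_mem _ hp)
  have h2 : ∀ p ∈ K, p.2 ∈ Prod.fst '' K ∪ Prod.snd '' K := fun p hp =>
    Or.inr (mem_image_of_mem _ hp)
  exact ⟨δ, max δ r,
    { pos := hδ
      le := le_max_left _ _
      detector := fun p hp x hx => ⟨hlow _ (h1 p hp) x hx, hup _ (Or.inr (h1 p hp)) x (Or.inl hx)⟩
      source := fun p hp x hx => ⟨hlow _ (h2 p hp) x hx, hup _ (Or.inr (h2 p hp)) x (Or.inl hx)⟩
      ne := fun p hp => (hKΩ p hp).1
      baseline := fun p hp => hup _ (Or.inr (h2 p hp)) _ (Or.inr (h1 p hp)) }⟩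

theorem ae_objMeasure {n : ℕ} {Ω : Set (Vec n)} {K : Set (Vec n × Vec n)}
    {ν : Measure (Vec n × Vec n)} [IsFiniteMeasure ν] (hν : ν Kᶜ = 0)
    {P : Vec n × (Vec n × Vec n) → Prop} (hP : MeasurableSet {q | P q})
    (h : ∀ p ∈ K, ∀ᵐ x ∂(volume : Measure (Vec n)).restrict Ω, P (x, p)) :
    ∀ᵐ q ∂objMeasure Ω ν, P q := by
  rw [objMeasure, Measure.ae_prod_iff_ae_ae hP, Measure.ae_ae_comm hP]
  have hKae : ∀ᵐ p ∂ν, p ∈ K := by rwa [ae_iff]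
  filter_upwards [hKae] with p hp using h p hp

theorem ae_objMeasure_fst {n : ℕ} {Ω : Set (Vec n)} {ν : Measure (Vec n × Vec n)}
    [IsFiniteMeasure ν] {P : Vec n → Prop}
    (h : ∀ᵐ x ∂(volume : Measure (Vec n)).restrict Ω, P x) : ∀ᵐ q ∂objMeasure Ω ν, P q.1 :=
  Measure.quasiMeasurePreserving_fst.ae h

/-! ### The X-ray transform as a bounded operator -/

section Segment

variable {n : ℕ} {Ω : Set (Vec n)} {K : Set (Vec n × Vec n)} {ν : Measure (Vec n × Vec n)}
  {e : Vec n × Vec n → Vec n} {δ R : ℝ}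

theorem measurable_segmentIntegral_comp (hΩ : MeasurableSet Ω) (he : Measurable e)
    {f : Vec n → ℝ} (hf : StronglyMeasurable f) :
    Measurable fun q : Vec n × (Vec n × Vec n) => segmentIntegral Ω f (e q.2) q.1 :=
  (measurable_segmentIntegral hΩ hf).comp
    (g := fun p : Vec n × Vec n => segmentIntegral Ω f p.1 p.2)
    (f := fun q : Vec n × (Vec n × Vec n) => (e q.2, q.1)) (by fun_prop)

theorem segmentIntegral_congr_ae_objMeasure [IsFiniteMeasure ν] (hΩ : MeasurableSet Ω)
    (hν : ν Kᶜ = 0) (he : Measurable e) (hδ : 0 < δ) (hδR : δ ≤ R)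
    (hc : ∀ p ∈ K, ∀ x ∈ Ω, δ ≤ ‖x - e p‖ ∧ ‖x - e p‖ ≤ R) {f g : Vec n → ℝ}
    (hf : StronglyMeasurable f) (hg : StronglyMeasurable g)
    (hfg : f =ᵐ[(volume : Measure (Vec n)).restrict Ω] g) :
    (fun q : Vec n × (Vec n × Vec n) => segmentIntegral Ω f (e q.2) q.1) =ᵐ[objMeasure Ω ν]
      fun q => segmentIntegral Ω g (e q.2) q.1 :=
  ae_objMeasure hν (measurableSet_eq_fun (measurable_segmentIntegral_comp hΩ he hf)
    (measurable_segmentIntegral_comp hΩ he hg))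
    fun p hp => segmentIntegral_congr_ae hΩ hδ hδR (hc p hp) hfg

theorem segmentIntegral_add_ae_objMeasure [IsFiniteMeasure ν] (hΩ : MeasurableSet Ω)
    (hν : ν Kᶜ = 0) (he : Measurable e) (hδ : 0 < δ) (hδR : δ ≤ R)
    (hc : ∀ p ∈ K, ∀ x ∈ Ω, δ ≤ ‖x - e p‖ ∧ ‖x - e p‖ ≤ R) {f g : Vec n → ℝ}
    (hfm : StronglyMeasurable f) (hf : IntegrableOn f Ω)
    (hgm : StronglyMeasurable g) (hg : IntegrableOn g Ω) :
    (fun q : Vec n × (Vec n × Vec n) => segmentIntegral Ω (f + g) (e q.2) q.1) =ᵐ[objMeasure Ω ν]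
      (fun q => segmentIntegral Ω f (e q.2) q.1) + fun q => segmentIntegral Ω g (e q.2) q.1 :=
  ae_objMeasure hν (measurableSet_eq_fun (measurable_segmentIntegral_comp hΩ he (hfm.add hgm))
    ((measurable_segmentIntegral_comp hΩ he hfm).add (measurable_segmentIntegral_comp hΩ he hgm)))
    fun p hp => segmentIntegral_add_ae hΩ hδ hδR (hc p hp) hfm hf hgm hg

theorem eLpNorm_segmentIntegral_two_le [IsFiniteMeasure ν] (hΩ : MeasurableSet Ω)
    (hν : ν Kᶜ = 0) (he : Measurable e) (hδ : 0 < δ) (hδR : δ ≤ R)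
    (hc : ∀ p ∈ K, ∀ x ∈ Ω, δ ≤ ‖x - e p‖ ∧ ‖x - e p‖ ≤ R) {f : Vec n → ℝ}
    (hf : StronglyMeasurable f) :
    eLpNorm (fun q => segmentIntegral Ω f (e q.2) q.1) 2 (objMeasure Ω ν) ≤
      (ENNReal.ofReal R ^ (2 : ℝ) * ENNReal.ofReal ((R / δ) ^ n) * ν univ) ^ (1 / 2 : ℝ) *
        eLpNorm f 2 ((volume : Measure (Vec n)).restrict Ω) := by
  have hKae : ∀ᵐ p ∂ν, p ∈ K := by rwa [ae_iff]
  have key : ∫⁻ q, ‖segmentIntegral Ω f (e q.2) q.1‖ₑ ^ (2 : ℝ) ∂objMeasure Ω ν ≤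
      ENNReal.ofReal R ^ (2 : ℝ) * ENNReal.ofReal ((R / δ) ^ n) * ν univ *
        ∫⁻ x in Ω, ‖f x‖ₑ ^ (2 : ℝ) := by
    rw [objMeasure, lintegral_prod_symm' _
      ((measurable_segmentIntegral_comp hΩ he hf).enorm.pow_const _)]
    calc ∫⁻ p, (∫⁻ x in Ω, ‖segmentIntegral Ω f (e p) x‖ₑ ^ (2 : ℝ)) ∂ν
        ≤ ∫⁻ _, (ENNReal.ofReal R ^ (2 : ℝ) * ENNReal.ofReal ((R / δ) ^ n) *
            ∫⁻ x in Ω, ‖f x‖ₑ ^ (2 : ℝ)) ∂ν := by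
          refine lintegral_mono_ae ?_
          filter_upwards [hKae] with p hp
          exact lintegral_segmentIntegral_sq_le hΩ hδ hδR (hc p hp) hf
      _ = _ := by
          rw [lintegral_const, mul_right_comm]
  rw [eLpNorm_eq_lintegral_rpow_enorm_toReal (by norm_num) (by norm_num),
    eLpNorm_eq_lintegral_rpow_enorm_toReal (by norm_num) (by norm_num), ENNReal.toReal_ofNat,
    ← ENNReal.mul_rpow_of_nonneg _ _ (by norm_num)]
  exact ENNReal.rpow_le_rpow key (by norm_num)

theorem abs_le_toReal_eLpNorm_top {α : Type*} [MeasurableSpace α] {μ : Measure α} {f : α → ℝ}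
    (hf : MemLp f ∞ μ) : ∀ᵐ x ∂μ, |f x| ≤ (eLpNorm f ∞ μ).toReal := by
  filter_upwards [enorm_ae_le_eLpNormEssSup f μ] with x hx
  rw [← eLpNorm_exponent_top] at hx
  simpa using ENNReal.toReal_mono hf.2.ne hx

theorem eLpNorm_segmentIntegral_top_le [IsFiniteMeasure ν] (hΩ : MeasurableSet Ω)
    (hν : ν Kᶜ = 0) (he : Measurable e) (hδ : 0 < δ) (hδR : δ ≤ R)
    (hc : ∀ p ∈ K, ∀ x ∈ Ω, δ ≤ ‖x - e p‖ ∧ ‖x - e p‖ ≤ R) {f : Vec n → ℝ}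
    (hf : StronglyMeasurable f) (hft : MemLp f ∞ ((volume : Measure (Vec n)).restrict Ω)) :
    eLpNorm (fun q => segmentIntegral Ω f (e q.2) q.1) ∞ (objMeasure Ω ν) ≤
      ENNReal.ofReal R * eLpNorm f ∞ ((volume : Measure (Vec n)).restrict Ω) := by
  have hae : ∀ᵐ q ∂objMeasure Ω ν, ‖segmentIntegral Ω f (e q.2) q.1‖ ≤
      R * (eLpNorm f ∞ ((volume : Measure (Vec n)).restrict Ω)).toReal :=
    ae_objMeasure hν (measurableSet_le (measurable_segmentIntegral_comp hΩ he hf).norm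
      measurable_const)
      fun p hp => abs_segmentIntegral_le_ae hΩ hδ hδR (hc p hp) ENNReal.toReal_nonneg
        (abs_le_toReal_eLpNorm_top hft)
  have h := eLpNormEssSup_le_of_ae_bound hae
  rwa [ENNReal.ofReal_mul (hδ.le.trans hδR), ENNReal.ofReal_toReal hft.2.ne,
    ← eLpNorm_exponent_top] at h

/-- Integration over the segments that start at `e p` is a bounded operator on `L^r`, as soon as it
satisfies a norm estimate. -/
theorem exists_segment_operator [IsFiniteMeasure ν] {r : ℝ≥0∞} [Fact (1 ≤ r)]
    (hΩ : MeasurableSet Ω)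
    (hΩb : Bornology.IsBounded Ω) (hν : ν Kᶜ = 0) (he : Measurable e) (hδ : 0 < δ) (hδR : δ ≤ R)
    (hc : ∀ p ∈ K, ∀ x ∈ Ω, δ ≤ ‖x - e p‖ ∧ ‖x - e p‖ ≤ R) {M : ℝ≥0∞} (hM : M ≠ ∞)
    (hbound : ∀ f : Vec n → ℝ, StronglyMeasurable f →
      MemLp f r ((volume : Measure (Vec n)).restrict Ω) →
      eLpNorm (fun q => segmentIntegral Ω f (e q.2) q.1) r (objMeasure Ω ν) ≤
        M * eLpNorm f r ((volume : Measure (Vec n)).restrict Ω)) :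
    ∃ S : Lp ℝ r ((volume : Measure (Vec n)).restrict Ω) →L[ℝ] Lp ℝ r (objMeasure Ω ν),
      ∀ f, S f =ᵐ[objMeasure Ω ν] fun q => segmentIntegral Ω f (e q.2) q.1 := by
  have hfin : IsFiniteMeasure ((volume : Measure (Vec n)).restrict Ω) :=
    ⟨by simpa using hΩb.measure_lt_top⟩
  have hr : 1 ≤ r := Fact.out
  have hMc : ((M.toNNReal : NNReal) : ℝ≥0∞) = M := ENNReal.coe_toNNReal hM
  have h := exists_continuousLinearMap_Lp (p := r) (q := r)
    (μ := (volume : Measure (Vec n)).restrict Ω) (ν := objMeasure Ω ν)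
    (fun f q => segmentIntegral Ω f (e q.2) q.1) M.toNNReal
    (fun f hf => (measurable_segmentIntegral_comp hΩ he hf).aestronglyMeasurable)
    (by simpa only [hMc] using hbound)
    (fun f g hf hg => segmentIntegral_congr_ae_objMeasure hΩ hν he hδ hδR hc hf hg)
    (fun f g hfm hgm hf hg => segmentIntegral_add_ae_objMeasure hΩ hν he hδ hδR hc hfm
      (hf.integrable hr) hgm (hg.integrable hr))
    (fun a f => funext fun q => segmentIntegral_smul Ω a f _ _)
  exact h

theorem exists_segment_operator_two [IsFiniteMeasure ν] (hΩ : MeasurableSet Ω)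
    (hΩb : Bornology.IsBounded Ω) (hν : ν Kᶜ = 0) (he : Measurable e) (hδ : 0 < δ) (hδR : δ ≤ R)
    (hc : ∀ p ∈ K, ∀ x ∈ Ω, δ ≤ ‖x - e p‖ ∧ ‖x - e p‖ ≤ R) :
    ∃ S : Lp ℝ 2 ((volume : Measure (Vec n)).restrict Ω) →L[ℝ] Lp ℝ 2 (objMeasure Ω ν),
      ∀ f, S f =ᵐ[objMeasure Ω ν] fun q => segmentIntegral Ω f (e q.2) q.1 :=
  exists_segment_operator hΩ hΩb hν he hδ hδR hc (by finiteness)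
    fun _ hf _ => eLpNorm_segmentIntegral_two_le hΩ hν he hδ hδR hc hf

theorem exists_segment_operator_top [IsFiniteMeasure ν] (hΩ : MeasurableSet Ω)
    (hΩb : Bornology.IsBounded Ω) (hν : ν Kᶜ = 0) (he : Measurable e) (hδ : 0 < δ) (hδR : δ ≤ R)
    (hc : ∀ p ∈ K, ∀ x ∈ Ω, δ ≤ ‖x - e p‖ ∧ ‖x - e p‖ ≤ R) :
    ∃ S : Lp ℝ ∞ ((volume : Measure (Vec n)).restrict Ω) →L[ℝ] Lp ℝ ∞ (objMeasure Ω ν),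
      ∀ f, S f =ᵐ[objMeasure Ω ν] fun q => segmentIntegral Ω f (e q.2) q.1 :=
  exists_segment_operator hΩ hΩb hν he hδ hδR hc ENNReal.ofReal_ne_top
    fun _ hf hft => eLpNorm_segmentIntegral_top_le hΩ hν he hδ hδR hc hf hft

end Segment

theorem exists_xray_operator_two {n : ℕ} {Ω : Set (Vec n)} {K : Set (Vec n × Vec n)}
    {ν : Measure (Vec n × Vec n)} [IsFiniteMeasure ν] {δ R : NNReal} (hΩ : MeasurableSet Ω)
    (hΩb : Bornology.IsBounded Ω) (hν : ν Kᶜ = 0) (hS : Separated Ω K δ R) :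
    ∃ T : Lp ℝ 2 ((volume : Measure (Vec n)).restrict Ω) →L[ℝ] Lp ℝ 2 (objMeasure Ω ν),
      ∀ f, T f =ᵐ[objMeasure Ω ν] xray Ω f := by
  obtain ⟨S₁, h₁⟩ := exists_segment_operator_two hΩ hΩb hν measurable_snd hS.pos hS.le hS.source
  obtain ⟨S₂, h₂⟩ := exists_segment_operator_two hΩ hΩb hν measurable_fst hS.pos hS.le hS.detector
  refine ⟨S₁ + S₂, fun f => ?_⟩
  filter_upwards [Lp.coeFn_add (S₁ f) (S₂ f), h₁ f, h₂ f] with q hq hq₁ hq₂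
  rw [add_apply, hq, Pi.add_apply, hq₁, hq₂, xray_eq]

theorem exists_xray_operator_top {n : ℕ} {Ω : Set (Vec n)} {K : Set (Vec n × Vec n)}
    {ν : Measure (Vec n × Vec n)} [IsFiniteMeasure ν] {δ R : NNReal} (hΩ : MeasurableSet Ω)
    (hΩb : Bornology.IsBounded Ω) (hν : ν Kᶜ = 0) (hS : Separated Ω K δ R) :
    ∃ T : Lp ℝ ∞ ((volume : Measure (Vec n)).restrict Ω) →L[ℝ] Lp ℝ ∞ (objMeasure Ω ν),
      ∀ f, T f =ᵐ[objMeasure Ω ν] xray Ω f := by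
  obtain ⟨S₁, h₁⟩ := exists_segment_operator_top hΩ hΩb hν measurable_snd hS.pos hS.le hS.source
  obtain ⟨S₂, h₂⟩ := exists_segment_operator_top hΩ hΩb hν measurable_fst hS.pos hS.le hS.detector
  refine ⟨S₁ + S₂, fun f => ?_⟩
  filter_upwards [Lp.coeFn_add (S₁ f) (S₂ f), h₁ f, h₂ f] with q hq hq₁ hq₂
  rw [add_apply, hq, Pi.add_apply, hq₁, hq₂, xray_eq]

theorem xray_congr_ae {n : ℕ} {Ω : Set (Vec n)} {K : Set (Vec n × Vec n)}
    {ν : Measure (Vec n × Vec n)} [IsFiniteMeasure ν] {δ R : NNReal} (hΩ : MeasurableSet Ω)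
    (hν : ν Kᶜ = 0) (hS : Separated Ω K δ R) {f g : Vec n → ℝ}
    (hf : StronglyMeasurable f) (hg : StronglyMeasurable g)
    (hfg : f =ᵐ[(volume : Measure (Vec n)).restrict Ω] g) :
    xray Ω f =ᵐ[objMeasure Ω ν] xray Ω g := by
  filter_upwards [segmentIntegral_congr_ae_objMeasure hΩ hν measurable_snd hS.pos hS.le hS.source
    hf hg hfg, segmentIntegral_congr_ae_objMeasure hΩ hν measurable_fst hS.pos hS.le hS.detector
    hf hg hfg] with q h₁ h₂
  rw [xray_eq, xray_eq, h₁, h₂]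

/-! ### The delta integral as a bounded operator -/

/-- The substitution `(x, d, s) ↦ (φ(x, d, s), d, s)` from object to data variables. -/
noncomputable def phaseMap {n : ℕ} (E₀ mc2 : ℝ) (q : Vec n × (Vec n × Vec n)) : ℝ × (Vec n × Vec n) :=
  (phase E₀ mc2 q.1 q.2.1 q.2.2, q.2)

theorem measurable_phaseMap {n : ℕ} (E₀ mc2 : ℝ) : Measurable (phaseMap (n := n) E₀ mc2) :=
  (measurable_phase E₀ mc2).prodMk measurable_snd

/-- The substitution `phaseMap`, restricted to energies in `𝔼`, maps `dx ⊗ dν` to a measure that is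
dominated by a multiple of `dE ⊗ dν`. -/
theorem exists_map_phaseMap_le {n : ℕ} (hn : 2 ≤ n) {E₀ mc2 : ℝ} (hE₀ : 0 < E₀) (hmc2 : 0 < mc2)
    {Ω : Set (Vec n)} (hΩ : MeasurableSet Ω) {𝔼 : Set ℝ} (h𝔼 : MeasurableSet 𝔼)
    (h𝔼c : closure 𝔼 ⊆ Ioo (comptonEnergy E₀ mc2 Real.pi) E₀)
    {K : Set (Vec n × Vec n)} {ν : Measure (Vec n × Vec n)} [IsFiniteMeasure ν] (hν : ν Kᶜ = 0)
    {δ R : NNReal} (hS : Separated Ω K δ R) :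
    ∃ M : NNReal, ((objMeasure Ω ν).restrict (phaseMap E₀ mc2 ⁻¹' (𝔼 ×ˢ univ))).map
      (phaseMap E₀ mc2) ≤ M • dataMeasure 𝔼 ν := by
  obtain ⟨k, hk⟩ := exists_lipschitzOnWith_comptonCot hE₀ hmc2 h𝔼c
  have hM : 2 * volume (Metric.closedBall (0 : Vec n) (2 * R)) * (k / (δ / R) : NNReal) ≠ ∞ :=
    ENNReal.mul_ne_top (ENNReal.mul_ne_top ENNReal.ofNat_ne_top measure_closedBall_lt_top.ne)
      ENNReal.coe_ne_top
  refine ⟨(2 * volume (Metric.closedBall (0 : Vec n) (2 * R)) *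
    (k / (δ / R) : NNReal)).toNNReal, Measure.le_iff.mpr fun S hSm => ?_⟩
  have hΦ := measurable_phaseMap (n := n) E₀ mc2
  have hsm : MeasurableSet (phaseMap (n := n) E₀ mc2 ⁻¹' (𝔼 ×ˢ univ)) :=
    hΦ (h𝔼.prod MeasurableSet.univ)
  have hKae : ∀ᵐ p ∂ν, p ∈ K := by rwa [ae_iff]
  rw [Measure.map_apply hΦ hSm, Measure.restrict_apply (hΦ hSm), Measure.smul_apply,
    Measure.prod_apply_symm ((hΦ hSm).inter hsm), Measure.prod_apply_symm hSm,
    ENNReal.smul_def, ENNReal.coe_toNNReal hM, smul_eq_mul,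
    ← lintegral_const_mul _ (measurable_measure_prodMk_right hSm)]
  refine lintegral_mono_ae ?_
  filter_upwards [hKae] with p hp
  have hA : MeasurableSet ((fun E : ℝ => (E, p)) ⁻¹' S) := measurable_prodMk_right hSm
  have h := volume_phase_mem_le hn hE₀ hmc2 hk hΩ (hS.ne p hp) hS.pos (hS.pos.trans_le hS.le)
    (hS.source p hp) (hS.baseline p hp) (A := (fun E : ℝ => (E, p)) ⁻¹' S ∩ 𝔼)
    inter_subset_right (hA.inter h𝔼)
  rw [Measure.restrict_apply hA, Measure.restrict_apply
    (measurable_prodMk_right ((hΦ hSm).inter hsm))]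
  refine le_trans (measure_mono ?_) h
  rintro x ⟨⟨hx1, hx2⟩, hxΩ⟩
  exact ⟨hxΩ, hx1, hx2.1⟩

theorem isFiniteMeasure_dataMeasure {n : ℕ} {𝔼 : Set ℝ} {a b : ℝ} (h𝔼c : closure 𝔼 ⊆ Ioo a b)
    (ν : Measure (Vec n × Vec n)) [IsFiniteMeasure ν] : IsFiniteMeasure (dataMeasure 𝔼 ν) := by
  have : IsFiniteMeasure ((volume : Measure ℝ).restrict 𝔼) := ⟨by
    rw [Measure.restrict_apply_univ]
    exact ((Metric.isBounded_Ioo a b).subset (subset_closure.trans h𝔼c)).measure_lt_top⟩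
  infer_instance

theorem indicator_comp_phaseMap_congr_ae {n : ℕ} {E₀ mc2 : ℝ} {Ω : Set (Vec n)} {𝔼 : Set ℝ}
    (h𝔼 : MeasurableSet 𝔼) {ν : Measure (Vec n × Vec n)} {M : NNReal}
    (hM : ((objMeasure Ω ν).restrict (phaseMap E₀ mc2 ⁻¹' (𝔼 ×ˢ univ))).map
      (phaseMap E₀ mc2) ≤ M • dataMeasure 𝔼 ν) {ψ ψ' : ℝ × (Vec n × Vec n) → ℝ}
    (hψ : ψ =ᵐ[dataMeasure 𝔼 ν] ψ') :
    (phaseMap E₀ mc2 ⁻¹' (𝔼 ×ˢ univ)).indicator (ψ ∘ phaseMap E₀ mc2) =ᵐ[objMeasure Ω ν]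
      (phaseMap E₀ mc2 ⁻¹' (𝔼 ×ˢ univ)).indicator (ψ' ∘ phaseMap E₀ mc2) := by
  have hΦ := measurable_phaseMap (n := n) E₀ mc2
  have hac : ((objMeasure Ω ν).restrict (phaseMap E₀ mc2 ⁻¹' (𝔼 ×ˢ univ))).map
      (phaseMap E₀ mc2) ≪ dataMeasure 𝔼 ν :=
    (Measure.absolutelyContinuous_of_le hM).trans Measure.smul_absolutelyContinuous
  have h1 := (ae_restrict_iff' (hΦ (h𝔼.prod MeasurableSet.univ))).mp
    (ae_of_ae_map hΦ.aemeasurable (hac.ae_le hψ))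
  filter_upwards [h1] with q hq
  by_cases hqs : q ∈ phaseMap E₀ mc2 ⁻¹' (𝔼 ×ˢ univ)
  · simp only [indicator_of_mem hqs]
    exact hq hqs
  · simp only [indicator_of_notMem hqs]

/-- Substitution of `φ(x, d, s)` for the energy is bounded from `L²` of the data to `L²` of the
object variables. -/
theorem exists_substitution_operator {n : ℕ} {E₀ mc2 : ℝ} {Ω : Set (Vec n)} {𝔼 : Set ℝ}
    (h𝔼 : MeasurableSet 𝔼) {ν : Measure (Vec n × Vec n)} {M : NNReal}
    (hM : ((objMeasure Ω ν).restrict (phaseMap E₀ mc2 ⁻¹' (𝔼 ×ˢ univ))).map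
      (phaseMap E₀ mc2) ≤ M • dataMeasure 𝔼 ν) :
    ∃ T : Lp ℝ 2 (dataMeasure 𝔼 ν) →L[ℝ] Lp ℝ 2 (objMeasure Ω ν),
      ∀ ψ, T ψ =ᵐ[objMeasure Ω ν]
        (phaseMap E₀ mc2 ⁻¹' (𝔼 ×ˢ univ)).indicator (ψ ∘ phaseMap E₀ mc2) := by
  have hΦ := measurable_phaseMap (n := n) E₀ mc2
  set s := phaseMap (n := n) E₀ mc2 ⁻¹' (𝔼 ×ˢ univ)
  have hs : MeasurableSet s := hΦ (h𝔼.prod MeasurableSet.univ)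
  have hMtop : (M : ℝ≥0∞) ^ (1 / (2 : ℝ≥0∞)).toReal ≠ ∞ := by finiteness
  have h := exists_continuousLinearMap_Lp (p := 2) (q := 2) (μ := dataMeasure 𝔼 ν)
    (ν := objMeasure Ω ν) (fun ψ => s.indicator (ψ ∘ phaseMap E₀ mc2))
    ((M : ℝ≥0∞) ^ (1 / (2 : ℝ≥0∞)).toReal).toNNReal
    (fun ψ hψ => ((hψ.comp_measurable hΦ).indicator hs).aestronglyMeasurable) ?_ ?_ ?_ ?_
  · exact h
  · intro ψ hψ _
    rw [ENNReal.coe_toNNReal hMtop, eLpNorm_indicator_eq_eLpNorm_restrict hs,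
      ← eLpNorm_map_measure hψ.aestronglyMeasurable hΦ.aemeasurable]
    refine (eLpNorm_mono_measure ψ hM).trans (le_of_eq ?_)
    rw [show M • dataMeasure 𝔼 ν = (M : ℝ≥0∞) • dataMeasure 𝔼 ν from rfl,
      eLpNorm_smul_measure_of_ne_top (by norm_num), smul_eq_mul]
  · exact fun ψ ψ' _ _ hψ => indicator_comp_phaseMap_congr_ae h𝔼 hM hψ
  · intro ψ ψ' _ _ _ _
    refine Filter.Eventually.of_forall fun q => ?_
    by_cases hqs : q ∈ s <;> simp [hqs]
  · intro a ψ
    funext q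
    by_cases hqs : q ∈ s <;> simp [hqs]

/-- The delta integral is the adjoint of the substitution of `φ(x, d, s)` for the energy. -/
theorem exists_deltaIntegral_operator {n : ℕ} (hn : 2 ≤ n) {E₀ mc2 : ℝ} (hE₀ : 0 < E₀)
    (hmc2 : 0 < mc2) {Ω : Set (Vec n)} (hΩ : MeasurableSet Ω) (hΩb : Bornology.IsBounded Ω)
    {𝔼 : Set ℝ} (h𝔼 : MeasurableSet 𝔼)
    (h𝔼c : closure 𝔼 ⊆ Ioo (comptonEnergy E₀ mc2 Real.pi) E₀)
    {K : Set (Vec n × Vec n)} {ν : Measure (Vec n × Vec n)} [IsFiniteMeasure ν] (hν : ν Kᶜ = 0)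
    {δ R : NNReal} (hS : Separated Ω K δ R) :
    ∃ D : Lp ℝ 2 (objMeasure Ω ν) →L[ℝ] Lp ℝ 2 (dataMeasure 𝔼 ν),
      ∀ (g : Lp ℝ 2 (objMeasure Ω ν)) (g' : Vec n × (Vec n × Vec n) → ℝ),
        g =ᵐ[objMeasure Ω ν] g' → IsDeltaIntegral E₀ mc2 Ω 𝔼 ν g' (D g) := by
  have hfin : IsFiniteMeasure ((volume : Measure (Vec n)).restrict Ω) :=
    ⟨by simpa using hΩb.measure_lt_top⟩
  have hdfin := isFiniteMeasure_dataMeasure h𝔼c ν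
  obtain ⟨M, hM⟩ := exists_map_phaseMap_le hn hE₀ hmc2 hΩ h𝔼 h𝔼c hν hS
  obtain ⟨T, hT⟩ := exists_substitution_operator h𝔼 hM
  refine ⟨ContinuousLinearMap.adjoint T, fun g g' hg => ⟨?_, ?_, fun ψ hψ hB => ?_⟩⟩
  · exact ((Lp.memLp g).integrable one_le_two).congr hg
  · exact (Lp.memLp _).integrable one_le_two
  · obtain ⟨B, hB⟩ := hB
    have hψm : MemLp ψ 2 (dataMeasure 𝔼 ν) :=
      MemLp.of_bound hψ.aestronglyMeasurable B (Filter.Eventually.of_forall hB)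
    have hae : T (hψm.toLp ψ) =ᵐ[objMeasure Ω ν]
        (phaseMap E₀ mc2 ⁻¹' (𝔼 ×ˢ univ)).indicator (ψ ∘ phaseMap E₀ mc2) :=
      (hT _).trans (indicator_comp_phaseMap_congr_ae h𝔼 hM hψm.coeFn_toLp)
    have hinner := ContinuousLinearMap.adjoint_inner_left T (hψm.toLp ψ) g
    rw [L2.inner_def, L2.inner_def] at hinner
    calc ∫ p, ContinuousLinearMap.adjoint T g p * ψ p ∂dataMeasure 𝔼 ν
        = ∫ p, inner ℝ (ContinuousLinearMap.adjoint T g p) (hψm.toLp ψ p) ∂dataMeasure 𝔼 ν := by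
          refine integral_congr_ae ?_
          filter_upwards [hψm.coeFn_toLp] with p hp
          rw [hp, real_inner_eq_re_inner, RCLike.inner_apply]
          simp [mul_comm]
      _ = ∫ q, inner ℝ (g q) (T (hψm.toLp ψ) q) ∂objMeasure Ω ν := hinner
      _ = _ := by
          refine integral_congr_ae ?_
          filter_upwards [hae, hg] with q hq hgq
          rw [hq, hgq, real_inner_eq_re_inner, RCLike.inner_apply]
          by_cases hqs : phase E₀ mc2 q.1 q.2.1 q.2.2 ∈ 𝔼
          · have : q ∈ phaseMap E₀ mc2 ⁻¹' (𝔼 ×ˢ univ) := ⟨hqs, mem_univ _⟩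
            simp [hqs, this, phaseMap, mul_comm]
          · have : q ∉ phaseMap E₀ mc2 ⁻¹' (𝔼 ×ˢ univ) := fun h => hqs h.1
            simp [hqs, this]

/-! ### Pullback, multiplication and exponential on `L^p` spaces -/

theorem exists_pullback_fst_operator_two {n : ℕ} {Ω : Set (Vec n)}
    (ν : Measure (Vec n × Vec n)) [IsFiniteMeasure ν] :
    ∃ P : Lp ℝ 2 ((volume : Measure (Vec n)).restrict Ω) →L[ℝ] Lp ℝ 2 (objMeasure Ω ν),
      ∀ f, P f =ᵐ[objMeasure Ω ν] fun q => f q.1 := by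
  have hMtop : ν univ ^ (1 / (2 : ℝ≥0∞)).toReal ≠ ∞ := by finiteness
  have h := exists_continuousLinearMap_Lp (p := 2) (q := 2)
    (μ := (volume : Measure (Vec n)).restrict Ω) (ν := objMeasure Ω ν)
    (fun f q => f q.1) (ν univ ^ (1 / (2 : ℝ≥0∞)).toReal).toNNReal
    (fun f hf => (hf.comp_measurable measurable_fst).aestronglyMeasurable) ?_
    (fun f g _ _ hfg => ae_objMeasure_fst hfg) (fun f g _ _ _ _ => Filter.EventuallyEq.rfl)
    (fun a f => rfl)
  · exact h
  · intro f hf _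
    have h1 := eLpNorm_map_measure (p := 2) (μ := objMeasure Ω ν)
      (hf.aestronglyMeasurable (μ := (objMeasure Ω ν).map Prod.fst)) measurable_fst.aemeasurable
    rw [ENNReal.coe_toNNReal hMtop]
    change eLpNorm (f ∘ Prod.fst) 2 _ ≤ _
    rw [← h1, objMeasure, Measure.map_fst_prod, eLpNorm_smul_measure_of_ne_top (by norm_num),
      smul_eq_mul]

theorem exists_inclusion_top_two {α : Type*} [MeasurableSpace α] (μ : Measure α)
    [IsFiniteMeasure μ] :
    ∃ I : Lp ℝ ∞ μ →L[ℝ] Lp ℝ 2 μ, ∀ f, I f =ᵐ[μ] f := by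
  have hMtop : μ univ ^ (1 / (2 : ℝ≥0∞).toReal - 1 / (∞ : ℝ≥0∞).toReal) ≠ ∞ := by simp
  have h := exists_continuousLinearMap_Lp (p := ∞) (q := 2) (μ := μ) (ν := μ)
    (fun f => f) (μ univ ^ (1 / (2 : ℝ≥0∞).toReal - 1 / (∞ : ℝ≥0∞).toReal)).toNNReal
    (fun f hf => hf.aestronglyMeasurable) (fun f hf _ => ?_)
    (fun f g _ _ hfg => hfg) (fun f g _ _ _ _ => Filter.EventuallyEq.rfl) (fun a f => rfl)
  · exact h
  · rw [ENNReal.coe_toNNReal hMtop, mul_comm]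
    exact eLpNorm_le_eLpNorm_mul_rpow_measure_univ le_top hf.aestronglyMeasurable

theorem memLp_top_exp_neg {α : Type*} [MeasurableSpace α] {μ : Measure α} (a : Lp ℝ ∞ μ) :
    MemLp (fun x => Real.exp (-(a x))) ∞ μ := by
  refine memLp_top_of_bound (Real.continuous_exp.comp_aestronglyMeasurable
    (Lp.aestronglyMeasurable a).neg) (Real.exp (eLpNorm a ∞ μ).toReal) ?_
  filter_upwards [abs_le_toReal_eLpNorm_top (Lp.memLp a)] with x hx
  rw [Real.norm_of_nonneg (Real.exp_pos _).le, Real.exp_le_exp]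
  exact (neg_le_abs _).trans hx

/-- Multiplication `L^∞ × L^p → L^p`. -/
noncomputable abbrev mulTop {α : Type*} [MeasurableSpace α] (μ : Measure α) (p : ℝ≥0∞) [Fact (1 ≤ p)] :
    Lp ℝ ∞ μ →L[ℝ] Lp ℝ p μ →L[ℝ] Lp ℝ p μ :=
  (ContinuousLinearMap.mul ℝ ℝ).holderL μ ∞ p p

theorem coeFn_mulTop {α : Type*} [MeasurableSpace α] {μ : Measure α} {p : ℝ≥0∞} [Fact (1 ≤ p)]
    (f : Lp ℝ ∞ μ) (g : Lp ℝ p μ) : mulTop μ p f g =ᵐ[μ] fun x => f x * g x :=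
  (ContinuousLinearMap.mul ℝ ℝ).coeFn_holder (r := p) f g

/-- The superposition operator `a ↦ exp (-a)` on `L^∞`. -/
noncomputable def expNeg {α : Type*} [MeasurableSpace α] {μ : Measure α} (a : Lp ℝ ∞ μ) : Lp ℝ ∞ μ :=
  (memLp_top_exp_neg a).toLp _

theorem coeFn_expNeg {α : Type*} [MeasurableSpace α] {μ : Measure α} (a : Lp ℝ ∞ μ) :
    expNeg a =ᵐ[μ] fun x => Real.exp (-(a x)) :=
  (memLp_top_exp_neg a).coeFn_toLp

/-- The remainder `exp (-a) (exp (-h) - 1 + h)` is bounded by `‖exp (-a)‖ ‖h‖²` for `‖h‖ ≤ 1`. -/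
theorem hasFDerivAt_expNeg {α : Type*} [MeasurableSpace α] {μ : Measure α} (a : Lp ℝ ∞ μ) :
    HasFDerivAt expNeg (-(mulTop μ ∞ (expNeg a))) a := by
  rw [hasFDerivAt_iff_isLittleO_nhds_zero]
  have hO : (fun h : Lp ℝ ∞ μ => expNeg (a + h) - expNeg a - (-(mulTop μ ∞ (expNeg a))) h)
      =O[nhds 0] fun h => ‖h‖ ^ 2 := by
    refine Asymptotics.IsBigO.of_bound ‖expNeg a‖ ?_
    filter_upwards [Metric.closedBall_mem_nhds (0 : Lp ℝ ∞ μ) one_pos] with h hh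
    rw [mem_closedBall_zero_iff] at hh
    have hbd : ∀ b : Lp ℝ ∞ μ, ∀ᵐ x ∂μ, |b x| ≤ ‖b‖ := fun b => by
      rw [Lp.norm_def]
      exact abs_le_toReal_eLpNorm_top (Lp.memLp b)
    have hle : ∀ᵐ x ∂μ, ‖(expNeg (a + h) - expNeg a - (-(mulTop μ ∞ (expNeg a))) h :
        Lp ℝ ∞ μ) x‖ ≤ ‖expNeg a‖ * ‖h‖ ^ 2 := by
      filter_upwards [Lp.coeFn_sub (expNeg (a + h) - expNeg a) ((-(mulTop μ ∞ (expNeg a))) h),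
        Lp.coeFn_sub (expNeg (a + h)) (expNeg a), Lp.coeFn_neg (mulTop μ ∞ (expNeg a) h),
        coeFn_mulTop (expNeg a) h, coeFn_expNeg a, coeFn_expNeg (a + h), Lp.coeFn_add a h,
        hbd h, hbd (expNeg a)] with x h1 h2 h3 h4 h5 h6 h7 h8 h9
      have h3' : ((-(mulTop μ ∞ (expNeg a))) h : Lp ℝ ∞ μ) x =
          -(Real.exp (-(a x)) * h x) := by
        rw [neg_apply, h3, Pi.neg_apply, h4, h5]
      rw [h5, abs_of_pos (Real.exp_pos _)] at h9
      rw [h1, Pi.sub_apply, h2, Pi.sub_apply, h3', h5, h6, h7, Pi.add_apply, Real.norm_eq_abs]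
      have hx1 : |-(h x)| ≤ 1 := by rw [abs_neg]; exact h8.trans hh
      have he := Real.abs_exp_sub_one_sub_id_le hx1
      have hsq : (-(h x)) ^ 2 ≤ ‖h‖ ^ 2 := by
        rw [neg_sq, ← sq_abs]
        gcongr
      have hfac : Real.exp (-(a x + h x)) - Real.exp (-(a x)) - -(Real.exp (-(a x)) * h x) =
          Real.exp (-(a x)) * (Real.exp (-(h x)) - 1 - -(h x)) := by
        rw [neg_add, Real.exp_add]; ring
      rw [hfac, abs_mul, abs_of_pos (Real.exp_pos _)]
      exact mul_le_mul h9 (he.trans hsq) (abs_nonneg _) (norm_nonneg _)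
    rw [norm_pow, norm_norm]
    have hnn : 0 ≤ ‖expNeg a‖ * ‖h‖ ^ 2 := by positivity
    rw [Lp.norm_def, eLpNorm_exponent_top]
    refine (ENNReal.toReal_mono ENNReal.ofReal_ne_top
      (eLpNormEssSup_le_of_ae_bound hle)).trans (le_of_eq ?_)
    rw [ENNReal.toReal_ofReal hnn]
  refine hO.trans_isLittleO ?_
  exact Asymptotics.isLittleO_norm_pow_id one_lt_two

/-! ### The weight -/

/-- The geometric factor `C / (‖x - s‖² ‖d - x‖²)` of the weight. -/
noncomputable def geometricFactor {n : ℕ} (C : ℝ) (q : Vec n × (Vec n × Vec n)) : ℝ :=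
  C / (‖q.1 - q.2.2‖ ^ 2 * ‖q.2.1 - q.1‖ ^ 2)

theorem weight_eq {n : ℕ} (C : ℝ) (Ω : Set (Vec n)) (f : Vec n → ℝ)
    (q : Vec n × (Vec n × Vec n)) :
    weight C Ω f q = geometricFactor C q * Real.exp (-xray Ω f q) := by
  rw [weight, geometricFactor, div_mul_eq_mul_div]

theorem memLp_top_geometricFactor {n : ℕ} {C : ℝ} (hC : 0 < C) {Ω : Set (Vec n)}
    {K : Set (Vec n × Vec n)} {ν : Measure (Vec n × Vec n)} [IsFiniteMeasure ν] {δ R : NNReal}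
    (hΩ : MeasurableSet Ω) (hν : ν Kᶜ = 0) (hS : Separated Ω K δ R) :
    MemLp (geometricFactor C) ∞ (objMeasure Ω ν) := by
  have hm : Measurable (geometricFactor (n := n) C) := by
    unfold geometricFactor; fun_prop
  have hδ : (0 : ℝ) < δ := by exact_mod_cast hS.pos
  refine memLp_top_of_bound hm.aestronglyMeasurable (C / ((δ : ℝ) ^ 2 * (δ : ℝ) ^ 2)) ?_
  refine ae_objMeasure hν (measurableSet_le hm.norm measurable_const) fun p hp => ?_
  filter_upwards [ae_restrict_mem hΩ] with x hx
  have h1 := (hS.source p hp x hx).1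
  have h2 := (hS.detector p hp x hx).1
  rw [norm_sub_rev] at h2
  rw [geometricFactor, Real.norm_of_nonneg (by positivity)]
  gcongr

/-- The weight factors through `L^∞` as `Γ exp (-T f)`, where `Γ` is the geometric factor and `T` is
the X-ray transform on `L^∞`. -/
theorem exists_weight_Linf {n : ℕ} {C : ℝ} (hC : 0 < C) {Ω : Set (Vec n)}
    {K : Set (Vec n × Vec n)} {ν : Measure (Vec n × Vec n)} [IsFiniteMeasure ν] {δ R : NNReal}
    (hΩ : MeasurableSet Ω) (hν : ν Kᶜ = 0) (hS : Separated Ω K δ R)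
    {T : Lp ℝ ∞ ((volume : Measure (Vec n)).restrict Ω) →L[ℝ] Lp ℝ ∞ (objMeasure Ω ν)}
    (hT : ∀ f, T f =ᵐ[objMeasure Ω ν] xray Ω f) :
    ∃ Γ : Lp ℝ ∞ (objMeasure Ω ν), ∀ f,
      mulTop _ ∞ Γ (expNeg (T f)) =ᵐ[objMeasure Ω ν] weight C Ω f := by
  have hΓ := memLp_top_geometricFactor hC hΩ hν hS
  refine ⟨hΓ.toLp _, fun f => ?_⟩
  filter_upwards [coeFn_mulTop (hΓ.toLp _) (expNeg (T f)), hΓ.coeFn_toLp, coeFn_expNeg (T f),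
    hT f] with q h1 h2 h3 h4
  rw [h1, h2, h3, h4, weight_eq]

/-! ### Fréchet derivatives -/

/-- Chain rule for `v ↦ Γ exp (-A v)`, with `A` linear. -/
theorem exists_hasFDerivAt_mulTop_expNeg {α : Type*} [MeasurableSpace α] {μ : Measure α}
    {X : Type*} [NormedAddCommGroup X] [NormedSpace ℝ X] (Γ : Lp ℝ ∞ μ) (A : X →L[ℝ] Lp ℝ ∞ μ)
    (u : X) :
    ∃ W' : X →L[ℝ] Lp ℝ ∞ μ, HasFDerivAt (fun v => mulTop μ ∞ Γ (expNeg (A v))) W' u ∧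
      ∀ h, W' h =ᵐ[μ] fun x => -(A h x) * mulTop μ ∞ Γ (expNeg (A u)) x := by
  have h1 : HasFDerivAt (fun v => expNeg (A v)) ((-(mulTop μ ∞ (expNeg (A u)))).comp A) u :=
    HasFDerivAt.comp u (hasFDerivAt_expNeg (A u)) A.hasFDerivAt
  refine ⟨(mulTop μ ∞ Γ).comp ((-(mulTop μ ∞ (expNeg (A u)))).comp A),
    HasFDerivAt.comp u (mulTop μ ∞ Γ).hasFDerivAt h1, fun h => ?_⟩
  change mulTop _ ∞ Γ (-(mulTop _ ∞ (expNeg (A u)) (A h))) =ᵐ[μ] _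
  filter_upwards [coeFn_mulTop Γ (-(mulTop _ ∞ (expNeg (A u)) (A h))),
    Lp.coeFn_neg (mulTop _ ∞ (expNeg (A u)) (A h)),
    coeFn_mulTop (expNeg (A u)) (A h), coeFn_mulTop Γ (expNeg (A u))] with q h1 h2 h3 h4
  rw [h1, h2, Pi.neg_apply, h3, h4]
  ring

/-- Product rule for `v ↦ D (W v · Q v)`, with `D` and `Q` linear. -/
theorem exists_hasFDerivAt_mulTop {α : Type*} [MeasurableSpace α] {μ : Measure α} {X Y : Type*}
    [NormedAddCommGroup X] [NormedSpace ℝ X] [NormedAddCommGroup Y] [NormedSpace ℝ Y]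
    {W : X → Lp ℝ ∞ μ} {W' : X →L[ℝ] Lp ℝ ∞ μ} {u : X} (hW : HasFDerivAt W W' u)
    (Q : X →L[ℝ] Lp ℝ 2 μ) (D : Lp ℝ 2 μ →L[ℝ] Y) :
    ∃ L' : X →L[ℝ] Y, HasFDerivAt (fun v => D (mulTop μ 2 (W v) (Q v))) L' u ∧
      ∀ h, L' h = D (mulTop μ 2 (W u) (Q h) + mulTop μ 2 (W' h) (Q u)) := by
  have h1 := (mulTop μ 2).hasFDerivAt_of_bilinear hW (Q.hasFDerivAt (x := u))
  exact ⟨_, HasFDerivAt.comp u D.hasFDerivAt h1, fun h => rfl⟩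

theorem isDeltaIntegral_integrand {n : ℕ} {C E₀ mc2 : ℝ} {Ω : Set (Vec n)} {𝔼 : Set ℝ}
    {ν : Measure (Vec n × Vec n)}
    {D : Lp ℝ 2 (objMeasure Ω ν) →L[ℝ] Lp ℝ 2 (dataMeasure 𝔼 ν)}
    (hD : ∀ (g : Lp ℝ 2 (objMeasure Ω ν)) (g' : Vec n × (Vec n × Vec n) → ℝ),
      g =ᵐ[objMeasure Ω ν] g' → IsDeltaIntegral E₀ mc2 Ω 𝔼 ν g' (D g)) {f : Vec n → ℝ}
    {W : Lp ℝ ∞ (objMeasure Ω ν)} (hW : W =ᵐ[objMeasure Ω ν] weight C Ω f)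
    {F : Lp ℝ 2 (objMeasure Ω ν)} (hF : F =ᵐ[objMeasure Ω ν] fun q => f q.1) :
    IsDeltaIntegral E₀ mc2 Ω 𝔼 ν (integrand C Ω f) (D (mulTop _ 2 W F)) := by
  refine hD _ _ ?_
  filter_upwards [coeFn_mulTop W F, hW, hF] with q h1 h2 h3
  rw [h1, h2, h3, integrand]

/-- The integrand of the derivative, for an arbitrary perturbation `V` of the weight. -/
theorem isDeltaIntegral_product_rule {n : ℕ} {C E₀ mc2 : ℝ} {Ω : Set (Vec n)} {𝔼 : Set ℝ}
    {ν : Measure (Vec n × Vec n)}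
    {D : Lp ℝ 2 (objMeasure Ω ν) →L[ℝ] Lp ℝ 2 (dataMeasure 𝔼 ν)}
    (hD : ∀ (g : Lp ℝ 2 (objMeasure Ω ν)) (g' : Vec n × (Vec n × Vec n) → ℝ),
      g =ᵐ[objMeasure Ω ν] g' → IsDeltaIntegral E₀ mc2 Ω 𝔼 ν g' (D g)) {f h : Vec n → ℝ}
    {W : Lp ℝ ∞ (objMeasure Ω ν)} (hW : W =ᵐ[objMeasure Ω ν] weight C Ω f)
    (V : Lp ℝ ∞ (objMeasure Ω ν))
    {F H : Lp ℝ 2 (objMeasure Ω ν)} (hF : F =ᵐ[objMeasure Ω ν] fun q => f q.1)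
    (hH : H =ᵐ[objMeasure Ω ν] fun q => h q.1) :
    IsDeltaIntegral E₀ mc2 Ω 𝔼 ν (fun q => V q * f q.1 + weight C Ω f q * h q.1)
      (D (mulTop _ 2 W H + mulTop _ 2 V F)) := by
  refine hD _ _ ?_
  filter_upwards [Lp.coeFn_add (mulTop _ 2 W H) (mulTop _ 2 V F), coeFn_mulTop W H,
    coeFn_mulTop V F, hF, hH, hW] with q h1 h2 h3 h4 h5 h6
  rw [h1, Pi.add_apply, h2, h3, h4, h5, h6, add_comm]

/-- The derivative of the forward operator at a bounded `f` extends to `L²(Ω)`. -/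
theorem exists_derivative_operator_two {n : ℕ} {C E₀ mc2 : ℝ} {Ω : Set (Vec n)} {𝔼 : Set ℝ}
    {K : Set (Vec n × Vec n)} {ν : Measure (Vec n × Vec n)} [IsFiniteMeasure ν] {δ R : NNReal}
    (hΩ : MeasurableSet Ω) (hν : ν Kᶜ = 0) (hS : Separated Ω K δ R)
    {T : Lp ℝ ∞ ((volume : Measure (Vec n)).restrict Ω) →L[ℝ] Lp ℝ ∞ (objMeasure Ω ν)}
    {T₂ P : Lp ℝ 2 ((volume : Measure (Vec n)).restrict Ω) →L[ℝ] Lp ℝ 2 (objMeasure Ω ν)}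
    (hT₂ : ∀ f, T₂ f =ᵐ[objMeasure Ω ν] xray Ω f)
    (hP : ∀ f, P f =ᵐ[objMeasure Ω ν] fun q => f q.1)
    {D : Lp ℝ 2 (objMeasure Ω ν) →L[ℝ] Lp ℝ 2 (dataMeasure 𝔼 ν)}
    (hD : ∀ (g : Lp ℝ 2 (objMeasure Ω ν)) (g' : Vec n × (Vec n × Vec n) → ℝ),
      g =ᵐ[objMeasure Ω ν] g' → IsDeltaIntegral E₀ mc2 Ω 𝔼 ν g' (D g))
    {Γ : Lp ℝ ∞ (objMeasure Ω ν)}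
    (hΓ : ∀ f, mulTop _ ∞ Γ (expNeg (T f)) =ᵐ[objMeasure Ω ν] weight C Ω f)
    {f : Lp ℝ 2 ((volume : Measure (Vec n)).restrict Ω)}
    (hf : MemLp f ∞ ((volume : Measure (Vec n)).restrict Ω)) :
    ∃ L : Lp ℝ 2 ((volume : Measure (Vec n)).restrict Ω) →L[ℝ] Lp ℝ 2 (dataMeasure 𝔼 ν),
      ∀ h : Lp ℝ 2 ((volume : Measure (Vec n)).restrict Ω),
        IsDeltaIntegral E₀ mc2 Ω 𝔼 ν (integrandDeriv C Ω f h) (L h) := by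
  set f' := hf.toLp f
  have hff' : f' =ᵐ[(volume : Measure (Vec n)).restrict Ω] f := hf.coeFn_toLp
  set W := mulTop (objMeasure Ω ν) ∞ Γ (expNeg (T f'))
  have hWf : W =ᵐ[objMeasure Ω ν] weight C Ω f := by
    filter_upwards [hΓ f', xray_congr_ae hΩ hν hS (Lp.stronglyMeasurable f')
      (Lp.stronglyMeasurable f) hff'] with q h1 h2
    rw [h1, weight, weight, h2]
  have hfq : MemLp (fun q : Vec n × (Vec n × Vec n) => f q.1) ∞ (objMeasure Ω ν) :=
    memLp_top_of_bound ((Lp.stronglyMeasurable f).comp_measurable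
      measurable_fst).aestronglyMeasurable _ (ae_objMeasure_fst (abs_le_toReal_eLpNorm_top hf))
  set F := hfq.toLp _
  refine ⟨D.comp ((mulTop _ 2 W).comp P - (mulTop _ 2 (mulTop _ ∞ W F)).comp T₂), fun h => ?_⟩
  refine hD (mulTop _ 2 W (P h) - mulTop _ 2 (mulTop _ ∞ W F) (T₂ h)) _ ?_
  filter_upwards [Lp.coeFn_sub (mulTop _ 2 W (P h)) (mulTop _ 2 (mulTop _ ∞ W F) (T₂ h)),
    coeFn_mulTop W (P h), coeFn_mulTop (mulTop _ ∞ W F) (T₂ h), coeFn_mulTop W F, hWf, hP h,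
    hT₂ h, hfq.coeFn_toLp] with q h1 h2 h3 h4 h5 h6 h7 h8
  rw [h1, Pi.sub_apply, h2, h3, h4, h5, h6, h7, h8, integrandDeriv, weightDeriv]
  ring

end ComptonScattering

open ComptonScattering in
theorem mainTheorem4 {n : ℕ} (hn : n = 2 ∨ n = 3) {C E₀ mc2 : ℝ} (hC : 0 < C) (hE₀ : 0 < E₀)
    (hmc2 : 0 < mc2)
    {Ω : Set (ComptonScattering.Vec n)} (hΩ : MeasurableSet Ω) (hΩb : Bornology.IsBounded Ω)
    {𝔼 : Set ℝ} (h𝔼 : MeasurableSet 𝔼)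
    (h𝔼c : closure 𝔼 ⊆ Ioo (ComptonScattering.comptonEnergy E₀ mc2 Real.pi) E₀)
    {K : Set (ComptonScattering.Vec n × ComptonScattering.Vec n)} (hK : IsCompact K)
    (hKΩ : ∀ p ∈ K, p.1 ≠ p.2 ∧ p.1 ∉ closure Ω ∧ p.2 ∉ closure Ω)
    (ν : Measure (ComptonScattering.Vec n × ComptonScattering.Vec n)) [IsFiniteMeasure ν]
    (hν : ν Kᶜ = 0)
    {X : Type*} [NormedAddCommGroup X] [NormedSpace ℝ X]
    (J : X →L[ℝ] Lp ℝ ∞ ((volume : Measure (ComptonScattering.Vec n)).restrict Ω)) :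
    -- `L₁` is well defined on `X`
    (∀ u : X, ComptonScattering.IsDeltaIntegral E₀ mc2 Ω 𝔼 ν
      (ComptonScattering.integrand C Ω (J u)) (ComptonScattering.L1 C E₀ mc2 Ω 𝔼 ν (J u))) ∧
    -- `W₁` and `L₁` are Fréchet differentiable at every `u`, with the stated derivatives
    (∃ hW : ∀ u : X, MemLp (ComptonScattering.weight C Ω (J u)) ∞
        (ComptonScattering.objMeasure Ω ν),
      ∀ u : X,
        ∃ (W' : X →L[ℝ] Lp ℝ ∞ (ComptonScattering.objMeasure Ω ν))
          (L' : X →L[ℝ] Lp ℝ 2 (ComptonScattering.dataMeasure 𝔼 ν)),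
          HasFDerivAt (fun v : X => (hW v).toLp (ComptonScattering.weight C Ω (J v))) W' u ∧
          (∀ h : X, W' h =ᵐ[ComptonScattering.objMeasure Ω ν]
            ComptonScattering.weightDeriv C Ω (J u) (J h)) ∧
          HasFDerivAt (fun v : X => ComptonScattering.L1 C E₀ mc2 Ω 𝔼 ν (J v)) L' u ∧
          (∀ h : X, ComptonScattering.IsDeltaIntegral E₀ mc2 Ω 𝔼 ν
            (fun q => W' h q * J u q.1 + ComptonScattering.weight C Ω (J u) q * J h q.1)
            (L' h))) ∧
    -- the derivative is a bounded operator on `L²(Ω)` at every bounded `f ∈ L²(Ω)`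
    (∀ f : Lp ℝ 2 ((volume : Measure (ComptonScattering.Vec n)).restrict Ω),
      MemLp f ∞ ((volume : Measure (ComptonScattering.Vec n)).restrict Ω) →
        ∃ D : Lp ℝ 2 ((volume : Measure (ComptonScattering.Vec n)).restrict Ω) →L[ℝ]
            Lp ℝ 2 (ComptonScattering.dataMeasure 𝔼 ν),
          ∀ h : Lp ℝ 2 ((volume : Measure (ComptonScattering.Vec n)).restrict Ω),
            ComptonScattering.IsDeltaIntegral E₀ mc2 Ω 𝔼 ν
              (ComptonScattering.integrandDeriv C Ω f h) (D h)) := by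
  have hn2 : 2 ≤ n := by omega
  have hfin : IsFiniteMeasure ((volume : Measure (Vec n)).restrict Ω) :=
    ⟨by simpa using hΩb.measure_lt_top⟩
  obtain ⟨δ, R, hS⟩ := exists_separated hΩb hK hKΩ
  obtain ⟨T, hT⟩ := exists_xray_operator_top hΩ hΩb hν hS
  obtain ⟨T₂, hT₂⟩ := exists_xray_operator_two hΩ hΩb hν hS
  obtain ⟨P, hP⟩ := exists_pullback_fst_operator_two (Ω := Ω) ν
  obtain ⟨I, hI⟩ := exists_inclusion_top_two ((volume : Measure (Vec n)).restrict Ω)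
  obtain ⟨D, hD⟩ := exists_deltaIntegral_operator hn2 hE₀ hmc2 hΩ hΩb h𝔼 h𝔼c hν hS
  obtain ⟨Γ, hΓ⟩ := exists_weight_Linf hC hΩ hν hS hT
  set A : X →L[ℝ] Lp ℝ ∞ (objMeasure Ω ν) := T.comp J
  set Q : X →L[ℝ] Lp ℝ 2 (objMeasure Ω ν) := P.comp (I.comp J)
  have hA : ∀ u : X, A u =ᵐ[objMeasure Ω ν] xray Ω (J u) := fun u => hT (J u)
  have hQ : ∀ u : X, Q u =ᵐ[objMeasure Ω ν] fun q => J u q.1 := fun u =>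
    (hP _).trans (ae_objMeasure_fst (hI (J u)))
  have hΓA : ∀ u : X, mulTop _ ∞ Γ (expNeg (A u)) =ᵐ[objMeasure Ω ν] weight C Ω (J u) :=
    fun u => hΓ (J u)
  have hdelta : ∀ u : X, IsDeltaIntegral E₀ mc2 Ω 𝔼 ν (integrand C Ω (J u))
      (D (mulTop _ 2 (mulTop _ ∞ Γ (expNeg (A u))) (Q u))) :=
    fun u => isDeltaIntegral_integrand hD (hΓA u) (hQ u)
  have hL1 : ∀ u : X, L1 C E₀ mc2 Ω 𝔼 ν (J u) =
      D (mulTop _ 2 (mulTop _ ∞ Γ (expNeg (A u))) (Q u)) := fun u =>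
    (hdelta u).deltaIntegral_eq
  have hW : ∀ u : X, MemLp (weight C Ω (J u)) ∞ (objMeasure Ω ν) := fun u =>
    (Lp.memLp _).ae_eq (hΓA u)
  have hWeq : ∀ u : X, (hW u).toLp (weight C Ω (J u)) = mulTop _ ∞ Γ (expNeg (A u)) :=
    fun u => Lp.ext ((hW u).coeFn_toLp.trans (hΓA u).symm)
  refine ⟨fun u => by rw [hL1]; exact hdelta u, ⟨hW, fun u => ?_⟩, fun f hf => ?_⟩
  · obtain ⟨W', hdW, hW'⟩ := exists_hasFDerivAt_mulTop_expNeg Γ A u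
    obtain ⟨L', hL', hL'eq⟩ := exists_hasFDerivAt_mulTop hdW Q D
    refine ⟨W', L', hdW.congr_of_eventuallyEq (.of_forall hWeq), fun h => ?_,
      hL'.congr_of_eventuallyEq (.of_forall hL1), fun h => ?_⟩
    · filter_upwards [hW' h, hΓA u, hA h] with q h1 h2 h3
      rw [h1, h2, h3, weightDeriv]
    · rw [hL'eq]
      exact isDeltaIntegral_product_rule hD (hΓA u) (W' h) (hQ u) (hQ h)
  · exact exists_derivative_operator_two hΩ hν hS hT₂ hP hD hΓ hf
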